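/- Let $q\ge 2$ be an integer and let $\mathfrak X$ be a homogeneous tree of degree $q+1$ (a connected graph without cycles in which every vertex has exactly $q+1$ neighbours), with graph distance $d$, a fixed vertex $o$, and $|x|=d(o,x)$. Let $\mathcal Lf(x)=f(x)-\frac1{q+1}\sum_{y:\,d(x,y)=1}f(y)$ for $f:\mathfrak X\to\mathbb C$, and put $$\gamma(z)=1-\frac{q^{1/2+iz}+q^{1/2-iz}}{q+1}\quad(z\in\mathbb C),\qquad \tau=\frac{2\pi}{\log q}.$$ Let $1<p<2$, $p'=p/(p-1)$ and $\delta_{p'}=\frac1{p'}-\frac12$; the numbers $\gamma(i\delta_{p'})$ and $\gamma(\tau/2+i\delta_{p'})$ are real. Let $\mathcal S_p(\mathfrak X)$ be the Fréchet space of all $f:\mathfrak X\to\mathbb C$ with $$\nu_m(f)=\sup_{x\in\mathfrak X}(1+|x|)^m q^{|x|/p}|f(x)|<\infty\quad\text{for all integers } m\ge 0 ,$$ with the topology given by the seminorms $\nu_m$. An $L^p$-tempered distribution is a linear functional $T:\mathcal S_p(\mathfrak X)\to\mathbb C$ such that $\langle T,f_n\rangle\to0$ whenever $\nu_m(f_n)\to0$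 for all $m$; its Laplacian is given by $\langle\mathcal LT,f\rangle=\langle T,\mathcal Lf\rangle$. Let $\lambda\in\mathbb C$, $\lambda\neq0$. Consider the sequences $(T_k)_{k\ge0}$ of $L^p$-tempered distributions such that 1. $\mathcal LT_k=\lambda T_{k+1}$ for all $k\ge0$, and 2. there are a continuous seminorm $\nu$ of $\mathcal S_p(\mathfrak X)$ and a constant $M>0$ with $|\langle T_k,\phi\rangle|\le M\nu(\phi)$ for all $k\ge0$ and all $\phi\in\mathcal S_p(\mathfrak X)$. Then: (a) If $|\lambda|=\gamma(i\delta_{p'})$, then every such sequence satisfies $\mathcal LT_0=|\lambda|\,T_0$. (b) If $|\lambda|<\gamma(i\delta_{p'})$, then every such sequence satisfies $T_k=0$ for all $k\ge0$. (c) If $\gamma(i\delta_{p'})<|\lambda|<\gamma(\tau/2+i\delta_{p'})$, then there is such a sequence in which no $T_k$ is an eigendistribution, that is, for no $k\ge0$ is there a $c\in\mathbb C$ with $\mathcal LT_k=cT_k$. -/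

import Mathlib

open Filter Topology

noncomputable section

namespace HomTree

/-- `G` is a homogeneous tree of degree `q + 1` with `q ≥ 2`. -/
structure IsHomogeneousTree {X : Type*} (G : SimpleGraph X) [G.LocallyFinite] (q : ℕ) :
    Prop where
  two_le : 2 ≤ q
  isTree : G.IsTree
  degree_eq : ∀ x, G.degree x = q + 1

/-- The Laplacian `𝓛 f (x) = f (x) - (q + 1)⁻¹ ∑_{y ∼ x} f (y)` on functions on the vertices. -/
def laplacian {X : Type*} (G : SimpleGraph X) [G.LocallyFinite] (q : ℕ) (f : X → ℂ) (x : X) : ℂ :=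
  f x - (1 / ((q : ℂ) + 1)) * ∑ y ∈ G.neighborFinset x, f y

/-- `γ(z) = 1 - (q^{1/2 + iz} + q^{1/2 - iz}) / (q + 1)`. -/
def gamma (q : ℕ) (z : ℂ) : ℂ :=
  1 - ((q : ℂ) ^ (1 / 2 + Complex.I * z) + (q : ℂ) ^ (1 / 2 - Complex.I * z)) / ((q : ℂ) + 1)

/-- `τ = 2π / log q`. -/
def tau (q : ℕ) : ℝ := 2 * Real.pi / Real.log q

/-- `δ_p = 1/p - 1/2`. -/
def delta (p : ℝ) : ℝ := 1 / p - 1 / 2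

/-- The weight `(1 + |x|)^m q^{|x|/p}`, where `|x| = d(o, x)`. -/
def weight {X : Type*} (G : SimpleGraph X) (q : ℕ) (o : X) (p : ℝ) (m : ℕ) (x : X) : ℝ :=
  (1 + (G.dist o x : ℝ)) ^ m * (q : ℝ) ^ ((G.dist o x : ℝ) / p)

theorem weight_nonneg {X : Type*} (G : SimpleGraph X) (q : ℕ) (o : X) (p : ℝ) (m : ℕ) (x : X) :
    0 ≤ weight G q o p m x := by
  unfold weight; positivity

/-- The `p`-Schwartz space `𝓢_p(𝔛)`: all `f` with
`sup_x (1 + |x|)^m q^{|x|/p} |f(x)| < ∞` for every `m`. -/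
def schwartz {X : Type*} (G : SimpleGraph X) (q : ℕ) (o : X) (p : ℝ) : Submodule ℂ (X → ℂ) where
  carrier := {f | ∀ m : ℕ, BddAbove (Set.range fun x => weight G q o p m x * ‖f x‖)}
  zero_mem' := by
    intro m
    refine ⟨0, ?_⟩
    rintro _ ⟨x, rfl⟩
    simp
  add_mem' := by
    intro f g hf hg m
    obtain ⟨A, hA⟩ := hf m
    obtain ⟨B, hB⟩ := hg m
    refine ⟨A + B, ?_⟩
    rintro _ ⟨x, rfl⟩
    have h1 := hA ⟨x, rfl⟩
    have h2 := hB ⟨x, rfl⟩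
    have h3 := mul_le_mul_of_nonneg_left (norm_add_le (f x) (g x)) (weight_nonneg G q o p m x)
    simp only [Pi.add_apply] at *
    linarith
  smul_mem' := by
    intro c f hf m
    obtain ⟨A, hA⟩ := hf m
    refine ⟨‖c‖ * A, ?_⟩
    rintro _ ⟨x, rfl⟩
    have h1 := mul_le_mul_of_nonneg_left (hA ⟨x, rfl⟩) (norm_nonneg c)
    simp only [Pi.smul_apply, smul_eq_mul, norm_mul] at *
    linarith

/-- The seminorm `ν_m(f) = sup_x (1 + |x|)^m q^{|x|/p} |f(x)|` on `𝓢_p(𝔛)`. -/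
def nu {X : Type*} (G : SimpleGraph X) (q : ℕ) (o : X) (p : ℝ) (m : ℕ) :
    Seminorm ℂ (schwartz G q o p) :=
  Seminorm.ofSMulLE (fun f => ⨆ x, weight G q o p m x * ‖f.1 x‖)
    (by simp)
    (by
      intro f g
      have : Nonempty X := ⟨o⟩
      refine ciSup_le fun x => ?_
      have h1 := le_ciSup (f.2 m) x
      have h2 := le_ciSup (g.2 m) x
      have h3 := mul_le_mul_of_nonneg_left (norm_add_le (f.1 x) (g.1 x))
        (weight_nonneg G q o p m x)
      simp only [Submodule.coe_add, Pi.add_apply] at *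
      linarith)
    (by
      intro c f
      have : Nonempty X := ⟨o⟩
      refine ciSup_le fun x => ?_
      have h1 := mul_le_mul_of_nonneg_left (le_ciSup (f.2 m) x) (norm_nonneg c)
      simp only [Submodule.coe_smul, Pi.smul_apply, smul_eq_mul, norm_mul] at *
      linarith)

/-- `f n → 0` in the Fréchet space `𝓢_p(𝔛)`: `ν_m (f n) → 0` for all `m`. -/
def TendstoZero {X : Type*} (G : SimpleGraph X) (q : ℕ) (o : X) (p : ℝ)
    (f : ℕ → schwartz G q o p) : Prop :=
  ∀ m : ℕ, Tendsto (fun n => nu G q o p m (f n)) atTop (𝓝 0)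

/-- A linear functional `T` on `𝓢_p(𝔛)` is an `L^p`-tempered distribution if `⟨T, f n⟩ → 0`
whenever `ν_m (f n) → 0` for all `m`. -/
def IsTempered {X : Type*} {G : SimpleGraph X} {q : ℕ} {o : X} {p : ℝ}
    (T : schwartz G q o p →ₗ[ℂ] ℂ) : Prop :=
  ∀ f : ℕ → schwartz G q o p, TendstoZero G q o p f → Tendsto (fun n => T (f n)) atTop (𝓝 0)

/-- A continuous seminorm of the Fréchet space `𝓢_p(𝔛)`. As `𝓢_p(𝔛)` is metrizable, continuity
is sequential continuity at `0`. -/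
def IsContinuousSeminorm {X : Type*} {G : SimpleGraph X} {q : ℕ} {o : X} {p : ℝ}
    (ν : Seminorm ℂ (schwartz G q o p)) : Prop :=
  ∀ f : ℕ → schwartz G q o p, TendstoZero G q o p f → Tendsto (fun n => ν (f n)) atTop (𝓝 0)

theorem dist_le_of_adj {X : Type*} {G : SimpleGraph X} (hG : G.Connected) (o : X) {x y : X}
    (h : G.Adj x y) : G.dist o x ≤ G.dist o y + 1 := by
  have h1 := hG.dist_triangle (u := o) (v := y) (w := x)
  have h2 : G.dist y x = 1 := SimpleGraph.dist_eq_one_iff_adj.2 h.symm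
  omega

/-- The weights at two neighbours are comparable. -/
theorem weight_le_of_adj {X : Type*} {G : SimpleGraph X} {q : ℕ} (hq : 1 ≤ q) (hG : G.Connected)
    (o : X) (p : ℝ) (m : ℕ) {x y : X} (h : G.Adj x y) :
    weight G q o p m x ≤ (2 ^ m * (q : ℝ) ^ |1 / p|) * weight G q o p m y := by
  have hxy : (G.dist o x : ℝ) ≤ G.dist o y + 1 := by exact_mod_cast dist_le_of_adj hG o h
  have hyx : (G.dist o y : ℝ) ≤ G.dist o x + 1 := by exact_mod_cast dist_le_of_adj hG o h.symm
  have hq1 : (1 : ℝ) ≤ q := by exact_mod_cast hq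
  have hy0 : (0 : ℝ) ≤ G.dist o y := by positivity
  have h1 : (1 + (G.dist o x : ℝ)) ^ m ≤ 2 ^ m * (1 + (G.dist o y : ℝ)) ^ m := by
    rw [← mul_pow]
    exact pow_le_pow_left₀ (by positivity) (by linarith) m
  have h2 : (q : ℝ) ^ ((G.dist o x : ℝ) / p) ≤
      (q : ℝ) ^ |1 / p| * (q : ℝ) ^ ((G.dist o y : ℝ) / p) := by
    rw [← Real.rpow_add (by linarith)]
    refine Real.rpow_le_rpow_of_exponent_le hq1 ?_
    have h3 : ((G.dist o x : ℝ) - G.dist o y) * (1 / p) ≤ |1 / p| := by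
      refine (le_abs_self _).trans ?_
      rw [abs_mul]
      have : |(G.dist o x : ℝ) - G.dist o y| ≤ 1 := abs_le.2 ⟨by linarith, by linarith⟩
      nlinarith [abs_nonneg (1 / p)]
    have h4 : ((G.dist o x : ℝ) - G.dist o y) * (1 / p)
        = (G.dist o x : ℝ) / p - (G.dist o y : ℝ) / p := by ring
    linarith
  unfold weight
  calc _ ≤ (2 ^ m * (1 + (G.dist o y : ℝ)) ^ m) *
      ((q : ℝ) ^ |1 / p| * (q : ℝ) ^ ((G.dist o y : ℝ) / p)) := by gcongr
    _ = _ := by ring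

/-- The Laplacian maps `𝓢_p(𝔛)` to itself. -/
theorem laplacian_mem {X : Type*} {G : SimpleGraph X} [G.LocallyFinite] {q : ℕ}
    (hG : IsHomogeneousTree G q) (o : X) (p : ℝ) {f : X → ℂ} (hf : f ∈ schwartz G q o p) :
    laplacian G q f ∈ schwartz G q o p := by
  intro m
  obtain ⟨A, hA⟩ := hf m
  have hq : 1 ≤ q := le_trans (by norm_num) hG.two_le
  set C : ℝ := 2 ^ m * (q : ℝ) ^ |1 / p| with hC
  have hC0 : 0 ≤ C := by positivity
  refine ⟨A + C * A, ?_⟩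
  rintro _ ⟨x, rfl⟩
  have hx : weight G q o p m x * ‖f x‖ ≤ A := hA ⟨x, rfl⟩
  have hw := weight_nonneg G q o p m x
  have hsum : weight G q o p m x * ‖∑ y ∈ G.neighborFinset x, f y‖ ≤ ((q : ℝ) + 1) * (C * A) := by
    calc weight G q o p m x * ‖∑ y ∈ G.neighborFinset x, f y‖
        ≤ weight G q o p m x * ∑ y ∈ G.neighborFinset x, ‖f y‖ :=
          mul_le_mul_of_nonneg_left (norm_sum_le _ _) hw
      _ = ∑ y ∈ G.neighborFinset x, weight G q o p m x * ‖f y‖ := Finset.mul_sum _ _ _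
      _ ≤ ∑ _y ∈ G.neighborFinset x, C * A := by
          refine Finset.sum_le_sum fun y hy => ?_
          have hadj : G.Adj x y := by simpa using hy
          have h1 := weight_le_of_adj hq hG.isTree.connected o p m hadj
          have h2 : weight G q o p m y * ‖f y‖ ≤ A := hA ⟨y, rfl⟩
          calc weight G q o p m x * ‖f y‖ ≤ (C * weight G q o p m y) * ‖f y‖ :=
                mul_le_mul_of_nonneg_right h1 (norm_nonneg _)
            _ = C * (weight G q o p m y * ‖f y‖) := by ring
            _ ≤ C * A := mul_le_mul_of_nonneg_left h2 hC0
      _ = ((q : ℝ) + 1) * (C * A) := by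
          rw [Finset.sum_const, SimpleGraph.card_neighborFinset_eq_degree, hG.degree_eq]
          simp
  have hn : ‖(1 / ((q : ℂ) + 1))‖ = 1 / ((q : ℝ) + 1) := by
    rw [norm_div, norm_one]
    congr 1
    have : ((q : ℂ) + 1) = ((q + 1 : ℕ) : ℂ) := by push_cast; rfl
    rw [this, Complex.norm_natCast]
    push_cast; rfl
  have hle : ‖laplacian G q f x‖ ≤
      ‖f x‖ + (1 / ((q : ℝ) + 1)) * ‖∑ y ∈ G.neighborFinset x, f y‖ := by
    unfold laplacian
    refine (norm_sub_le _ _).trans ?_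
    rw [norm_mul, hn]
  have hq0 : (0 : ℝ) < (q : ℝ) + 1 := by positivity
  calc weight G q o p m x * ‖laplacian G q f x‖
      ≤ weight G q o p m x *
        (‖f x‖ + (1 / ((q : ℝ) + 1)) * ‖∑ y ∈ G.neighborFinset x, f y‖) :=
        mul_le_mul_of_nonneg_left hle hw
    _ = weight G q o p m x * ‖f x‖ + (1 / ((q : ℝ) + 1)) *
        (weight G q o p m x * ‖∑ y ∈ G.neighborFinset x, f y‖) := by ring
    _ ≤ A + (1 / ((q : ℝ) + 1)) * (((q : ℝ) + 1) * (C * A)) := by gcongr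
    _ = A + C * A := by field_simp

/-- The Laplacian as a linear map on `𝓢_p(𝔛)`. -/
def laplacianSchwartz {X : Type*} {G : SimpleGraph X} [G.LocallyFinite] {q : ℕ}
    (hG : IsHomogeneousTree G q) (o : X) (p : ℝ) :
    schwartz G q o p →ₗ[ℂ] schwartz G q o p where
  toFun f := ⟨laplacian G q f.1, laplacian_mem hG o p f.2⟩
  map_add' f g := by
    ext x
    simp only [laplacian, Submodule.coe_add, Pi.add_apply, Finset.sum_add_distrib]
    ring
  map_smul' c f := by
    ext x
    simp only [laplacian, Submodule.coe_smul, Pi.smul_apply, smul_eq_mul, RingHom.id_apply,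
      ← Finset.mul_sum]
    ring

/-- The Laplacian of a distribution: `⟨𝓛 T, f⟩ = ⟨T, 𝓛 f⟩`. -/
def laplacianDist {X : Type*} {G : SimpleGraph X} [G.LocallyFinite] {q : ℕ}
    (hG : IsHomogeneousTree G q) {o : X} {p : ℝ} (T : schwartz G q o p →ₗ[ℂ] ℂ) :
    schwartz G q o p →ₗ[ℂ] ℂ :=
  T ∘ₗ laplacianSchwartz hG o p

/-- A sequence of `L^p`-tempered distributions with `𝓛 T_k = lam T_{k+1}` for all `k ≥ 0`, and
`|⟨T_k, φ⟩| ≤ M ν(φ)` for all `k` and `φ`, with one constant `M > 0` and one continuous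
seminorm `ν` of `𝓢_p(𝔛)`. -/
structure IsRoeSequence {X : Type*} {G : SimpleGraph X} [G.LocallyFinite] {q : ℕ}
    (hG : IsHomogeneousTree G q) {o : X} {p : ℝ} (lam : ℂ)
    (T : ℕ → (schwartz G q o p →ₗ[ℂ] ℂ)) : Prop where
  tempered : ∀ k, IsTempered (T k)
  laplacian_eq : ∀ k, laplacianDist hG (T k) = lam • T (k + 1)
  bounded : ∃ ν : Seminorm ℂ (schwartz G q o p), IsContinuousSeminorm ν ∧
    ∃ M : ℝ, 0 < M ∧ ∀ k φ, ‖T k φ‖ ≤ M * ν φ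

/-- `γ(iδ)` is a real number for real `δ`. -/
theorem gamma_I_mul (q : ℕ) (d : ℝ) : gamma q (Complex.I * d) =
    ((1 - ((q : ℝ) ^ (1 / 2 - d) + (q : ℝ) ^ (1 / 2 + d)) / ((q : ℝ) + 1) : ℝ) : ℂ) := by
  have h : Complex.I * (Complex.I * d) = -(d : ℂ) := by
    rw [← mul_assoc, Complex.I_mul_I]; ring
  have hq : (0 : ℝ) ≤ q := by positivity
  unfold gamma
  rw [h]
  push_cast [Complex.ofReal_cpow hq]
  ring_nf

/-- `γ(τ/2 + iδ)` is a real number for real `δ`. -/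
theorem gamma_tau_add_I_mul {q : ℕ} (hq : 2 ≤ q) (d : ℝ) :
    gamma q ((tau q : ℂ) / 2 + Complex.I * d) =
    ((1 + ((q : ℝ) ^ (1 / 2 - d) + (q : ℝ) ^ (1 / 2 + d)) / ((q : ℝ) + 1) : ℝ) : ℂ) := by
  have hq0 : (0 : ℝ) ≤ q := by positivity
  have hqc : (q : ℂ) ≠ 0 := by
    have : q ≠ 0 := by omega
    exact_mod_cast this
  have hlog : Real.log q ≠ 0 := (Real.log_pos (by exact_mod_cast hq)).ne'
  have hL : Complex.log (q : ℂ) = (Real.log q : ℂ) := by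
    rw [Complex.natCast_log]
  have hlc : (Real.log q : ℂ) ≠ 0 := by exact_mod_cast hlog
  have e1 : (q : ℂ) ^ (Complex.I * ((tau q : ℂ) / 2)) = -1 := by
    rw [Complex.cpow_def_of_ne_zero hqc, hL, ← Complex.exp_pi_mul_I]
    congr 1
    unfold tau
    rw [Complex.ofReal_div, Complex.ofReal_mul]
    rw [Complex.ofReal_ofNat]
    field_simp
  have h : Complex.I * ((tau q : ℂ) / 2 + Complex.I * d) =
      Complex.I * ((tau q : ℂ) / 2) - d := by
    rw [mul_add, ← mul_assoc Complex.I Complex.I, Complex.I_mul_I]; ring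
  have h1 : (1 / 2 : ℂ) + (Complex.I * ((tau q : ℂ) / 2) - d) =
      Complex.I * ((tau q : ℂ) / 2) + (1 / 2 - d) := by ring
  have h2 : (1 / 2 : ℂ) - (Complex.I * ((tau q : ℂ) / 2) - d) =
      -(Complex.I * ((tau q : ℂ) / 2)) + (1 / 2 + d) := by ring
  unfold gamma
  rw [h, h1, h2, Complex.cpow_add _ _ hqc, Complex.cpow_add _ _ hqc, Complex.cpow_neg, e1]
  push_cast [Complex.ofReal_cpow hq0]
  ring_nf

end HomTree

end

open HomTree

/-! Write `A = 1 - 𝓛` for the averaging operator, `t = q^(-1/p)` and `ρ = (q t + t⁻¹)/(q + 1)`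
(`rate`); then `γ(iδ_{p'}) = 1 - ρ` and `γ(τ/2 + iδ_{p'}) = 1 + ρ`. Since `A` multiplies `t^|x|` by
at most `ρ`, the seminorm `ν_m(Aⁿψ)` is at most `(1 + n)^m ρⁿ ν_m(ψ)` (`nu_average_pow_le`). The
relation `𝓛 T_k = λ T_{k+1}` says that `F(k, n) = T_k(Aⁿψ)` satisfies `F(k, n) = F(k, n+1) + λ
F(k+1, n)`: it is harmonic for a weighted walk on `ℕ × ℕ`, and condition 2 bounds it uniformly in
`k`.

(b) When `ρ + |λ| < 1`, `N` steps of the walk bound `F` by a polynomial in `N` times `(ρ + |λ|)^N`,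
which tends to `0`.

(a) When `ρ + |λ| = 1`, rescaling by `ρ⁻ⁿ` and by the phase of `λ` turns the weights into the
probabilities `ρ`, `1 - ρ`, and `F` is bounded in `k` and of polynomial growth in `n`. A Liouville
theorem (`IsHarmonic.diff_eq_zero`) makes `F` constant on antidiagonals, whence `T_0 = (λ/|λ|) T_1`.
For Liouville, the difference along antidiagonals falls on the binomial weights of the `N`-step
walk, whose variation is of order `N^(-1/2)`. Each difference thus lowers the growth in `n` by a
square root until an iterate vanishes; boundedness in `k` then removes the iterations one by one.

(c) Spherical functions with parameter `α`, `|α| = t`, define tempered distributions. Their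
averaging eigenvalues `(q α + α⁻¹)/(q + 1)` fill an ellipse through `±ρ`, nondegenerate as `p ≠ 2`.
Some conjugate pair `μ`, `μ̄` has `|1 - μ| = |λ|`, and combining the two eigendistributions gives
the sequence. -/

/-! ### Binomial averages: mean, deviation, variance. -/

/-- The binomial expansion in an algebra, with scalar weights. -/
theorem Commute.smul_add_smul_pow {R : Type*} [Ring R] [Algebra ℂ R] {a b : R} (h : Commute a b)
    (x y : ℂ) (N : ℕ) :
    (x • a + y • b) ^ N = ∑ j ∈ Finset.range (N + 1),
      ((N.choose j : ℂ) * x ^ j * y ^ (N - j)) • (a ^ j * b ^ (N - j)) := by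
  have hc : Commute (x • a) (y • b) := (h.smul_left x).smul_right y
  rw [hc.add_pow]
  refine Finset.sum_congr rfl fun j _ => ?_
  rw [smul_pow, smul_pow, smul_mul_smul_comm, ← (Nat.cast_commute (N.choose j) _).eq,
    ← nsmul_eq_mul, ← Nat.cast_smul_eq_nsmul ℂ, smul_smul, mul_assoc]

/-- The expected value of `j` in the binomial expansion of `(x a + y b) ^ (N + 1)`. -/
theorem Commute.binomial_mean {R : Type*} [Ring R] [Algebra ℂ R] {a b : R} (h : Commute a b)
    (x y : ℂ) (N : ℕ) :
    ∑ j ∈ Finset.range (N + 2), (((N + 1).choose j : ℂ) * x ^ j * y ^ (N + 1 - j) * j) •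
      (a ^ j * b ^ (N + 1 - j)) = ((N + 1) * x) • (a * (x • a + y • b) ^ N) := by
  rw [Finset.sum_range_succ', h.smul_add_smul_pow, Finset.mul_sum, Finset.smul_sum]
  simp only [Nat.cast_zero, mul_zero, zero_smul, add_zero]
  refine Finset.sum_congr rfl fun j _ => ?_
  have h1 : (((N + 1).choose (j + 1) : ℂ)) * ((j : ℂ) + 1) = ((N : ℂ) + 1) * N.choose j := by
    exact_mod_cast (Nat.add_one_mul_choose_eq N j).symm
  rw [mul_smul_comm, smul_smul, Nat.add_sub_add_right, pow_succ' a, mul_assoc a]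
  congr 1
  push_cast
  linear_combination x ^ (j + 1) * y ^ (N - j) * h1

/-- The deviation from the mean in a binomial average is a discrete derivative. -/
theorem Commute.binomial_deviation {R : Type*} [Ring R] [Algebra ℂ R] {a b : R} (h : Commute a b)
    {x y : ℂ} (hxy : x + y = 1) (N : ℕ) :
    ∑ j ∈ Finset.range (N + 2), (((N + 1).choose j : ℂ) * x ^ j * y ^ (N + 1 - j) *
      ((j : ℂ) - (N + 1) * x)) • (a ^ j * b ^ (N + 1 - j)) =
      ((N + 1) * x * y) • ((a - b) * (x • a + y • b) ^ N) := by
  simp only [mul_sub, sub_smul, Finset.sum_sub_distrib]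
  rw [h.binomial_mean]
  simp only [mul_comm _ (((N : ℂ) + 1) * x), mul_smul ((((N : ℂ) + 1) * x))]
  rw [← Finset.smul_sum, ← h.smul_add_smul_pow, pow_succ', ← smul_sub, ← sub_mul]
  have : a - (x • a + y • b) = y • (a - b) := by
    rw [← eq_sub_iff_add_eq] at hxy
    subst hxy
    module
  rw [this, smul_mul_assoc]

/-- Variance of the binomial distribution. -/
theorem sum_binomial_mul_deviation_sq (x : ℝ) (n : ℕ) :
    ∑ j ∈ Finset.range (n + 1), (n.choose j * x ^ j * (1 - x) ^ (n - j)) * ((j : ℝ) - n * x) ^ 2 =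
      n * x * (1 - x) := by
  have h := congrArg (Polynomial.eval x) (bernsteinPolynomial.variance ℝ n)
  simp only [bernsteinPolynomial, Polynomial.eval_finsetSum, Polynomial.eval_mul,
    Polynomial.eval_pow, Polynomial.eval_sub, Polynomial.eval_X, Polynomial.eval_one,
    Polynomial.eval_natCast, nsmul_eq_mul] at h
  rw [← h]
  refine Finset.sum_congr rfl fun j _ => ?_
  ring

/-- Mean absolute deviation of the binomial distribution. -/
theorem sum_binomial_mul_abs_deviation_le {x : ℝ} (hx0 : 0 ≤ x) (hx1 : x ≤ 1) (n : ℕ) :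
    ∑ j ∈ Finset.range (n + 1), (n.choose j * x ^ j * (1 - x) ^ (n - j)) * |(j : ℝ) - n * x| ≤
      √(n * x * (1 - x)) := by
  have hw : ∀ j, 0 ≤ (n.choose j * x ^ j * (1 - x) ^ (n - j) : ℝ) := fun j => by
    have : 0 ≤ 1 - x := by linarith
    positivity
  have h1 : ∑ j ∈ Finset.range (n + 1), (n.choose j * x ^ j * (1 - x) ^ (n - j) : ℝ) = 1 := by
    have := add_pow x (1 - x) n
    rw [add_sub_cancel, one_pow] at this
    exact (Finset.sum_congr rfl fun j _ => by ring).trans this.symm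
  refine Real.le_sqrt_of_sq_le ?_
  -- Cauchy–Schwarz against the probability weights: the mean absolute deviation is at most the
  -- standard deviation.
  have := Finset.sum_sq_le_sum_mul_sum_of_sq_le_mul (Finset.range (n + 1))
    (r := fun j => (n.choose j * x ^ j * (1 - x) ^ (n - j)) * |(j : ℝ) - n * x|)
    (f := fun j => (n.choose j * x ^ j * (1 - x) ^ (n - j) : ℝ))
    (g := fun j => (n.choose j * x ^ j * (1 - x) ^ (n - j)) * ((j : ℝ) - n * x) ^ 2)
    (fun j _ => hw j) (fun j _ => mul_nonneg (hw j) (sq_nonneg _))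
    (fun j _ => by rw [mul_pow, sq_abs]; exact le_of_eq (by ring))
  rwa [h1, one_mul, sum_binomial_mul_deviation_sq] at this

/-! ### Harmonic functions on `ℕ × ℕ` and Liouville's theorem. -/

/-- The shift of the first variable, on functions on `ℕ × ℕ`. -/
def shiftFst : Module.End ℂ (ℕ → ℕ → ℂ) where
  toFun F k n := F (k + 1) n
  map_add' _ _ := rfl
  map_smul' _ _ := rfl

/-- The shift of the second variable, on functions on `ℕ × ℕ`. -/
def shiftSnd : Module.End ℂ (ℕ → ℕ → ℂ) where
  toFun F k n := F k (n + 1)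
  map_add' _ _ := rfl
  map_smul' _ _ := rfl

theorem commute_shift : Commute shiftSnd shiftFst := rfl

theorem shiftFst_pow_apply (j : ℕ) (F : ℕ → ℕ → ℂ) (k n : ℕ) :
    (shiftFst ^ j) F k n = F (k + j) n := by
  induction j generalizing F with
  | zero => rfl
  | succ j ih => rw [pow_succ, Module.End.mul_apply, ih]; rfl

theorem shiftSnd_pow_apply (j : ℕ) (F : ℕ → ℕ → ℂ) (k n : ℕ) :
    (shiftSnd ^ j) F k n = F k (n + j) := by
  induction j generalizing F with
  | zero => rfl
  | succ j ih => rw [pow_succ, Module.End.mul_apply, ih]; rfl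

/-- `F` is harmonic for the walk on `ℕ × ℕ` with steps `(0, 1)` and `(1, 0)` of weights `x`, `y`. -/
def IsHarmonic (x y : ℂ) (F : ℕ → ℕ → ℂ) : Prop :=
  ∀ k n, F k n = x * F k (n + 1) + y * F (k + 1) n

namespace IsHarmonic

variable {x y : ℂ} {F : ℕ → ℕ → ℂ}

theorem pow_apply (h : IsHarmonic x y F) (N : ℕ) :
    ((x • shiftSnd + y • shiftFst) ^ N) F = F := by
  induction N with
  | zero => rfl
  | succ N ih =>
    rw [pow_succ', Module.End.mul_apply, ih]
    funext k n
    exact (h k n).symm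

theorem eq_sum (h : IsHarmonic x y F) (N k n : ℕ) :
    F k n = ∑ j ∈ Finset.range (N + 1),
      ((N.choose j : ℂ) * x ^ j * y ^ (N - j)) * F (k + (N - j)) (n + j) := by
  have h1 := congrFun (congrFun (h.pow_apply N) k) n
  rw [commute_shift.smul_add_smul_pow] at h1
  rw [← h1]
  simp [LinearMap.sum_apply, shiftSnd_pow_apply, shiftFst_pow_apply]

/-- The difference of `F` at the two points that are one step away. -/
theorem diff (h : IsHarmonic x y F) :
    IsHarmonic x y fun k n => F k (n + 1) - F (k + 1) n := by
  intro k n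
  linear_combination h k (n + 1) - h (k + 1) n

/-- Summation by parts: `Commute.binomial_deviation` is applied to `F`, and the power of the walk
operator on its right side fixes `F`, leaving the bare difference. -/
theorem diff_eq_sum (h : IsHarmonic x y F) (hxy : x + y = 1) (N k n : ℕ) :
    ((N + 1) * x * y) * (F k (n + 1) - F (k + 1) n) = ∑ j ∈ Finset.range (N + 2),
      ((N + 1).choose j * x ^ j * y ^ (N + 1 - j) * ((j : ℂ) - (N + 1) * x)) *
        F (k + (N + 1 - j)) (n + j) := by
  have h1 := congrArg (fun A : Module.End ℂ (ℕ → ℕ → ℂ) => A F k n)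
    (commute_shift.binomial_deviation hxy N)
  simp only [LinearMap.smul_apply, Module.End.mul_apply, h.pow_apply, LinearMap.sum_apply,
    Finset.sum_apply, Pi.smul_apply, smul_eq_mul, shiftSnd_pow_apply, shiftFst_pow_apply] at h1
  rw [h1]
  rfl

end IsHarmonic

/-- In `diff_eq_sum` the prefactor is the variance of `N + 1` steps while the sum is at most the
standard deviation times `B`, so one inverse standard deviation is gained. -/
theorem IsHarmonic.norm_diff_le {r : ℝ} {F : ℕ → ℕ → ℂ}
    (h : IsHarmonic r (1 - r : ℝ) F) (hr0 : 0 < r) (hr1 : r < 1) {N k n : ℕ} {B : ℝ}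
    (hB : ∀ l, ∀ j ≤ N + 1, ‖F l (n + j)‖ ≤ B) :
    ‖F k (n + 1) - F (k + 1) n‖ ≤ B / √((N + 1) * (r * (1 - r))) := by
  have hr2 : 0 < 1 - r := by linarith
  have hB0 : 0 ≤ B := (norm_nonneg _).trans (hB 0 0 (by omega))
  have h1 := h.diff_eq_sum (by push_cast; ring) N k n
  have hc : 0 < ((N : ℝ) + 1) * (r * (1 - r)) := by positivity
  have e1 : ((N : ℂ) + 1) * r * (1 - r : ℝ) = (((N : ℝ) + 1) * (r * (1 - r)) : ℝ) := by
    push_cast; ring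
  have h2 : (((N : ℝ) + 1) * (r * (1 - r))) * ‖F k (n + 1) - F (k + 1) n‖ ≤
      √(((N : ℝ) + 1) * (r * (1 - r))) * B := by
    calc _ = ‖((N : ℂ) + 1) * r * (1 - r : ℝ) * (F k (n + 1) - F (k + 1) n)‖ := by
          rw [norm_mul, e1, Complex.norm_real, Real.norm_of_nonneg hc.le]
      _ ≤ ∑ j ∈ Finset.range (N + 2), ((N + 1).choose j * r ^ j * (1 - r) ^ (N + 1 - j)) *
            |(j : ℝ) - (N + 1 : ℕ) * r| * B := by
          rw [h1]
          refine norm_sum_le_of_le _ fun j hj => ?_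
          have e2 : ((N + 1).choose j * (r : ℂ) ^ j * ((1 - r : ℝ) : ℂ) ^ (N + 1 - j) *
              ((j : ℂ) - (N + 1) * r)) = (((N + 1).choose j * r ^ j * (1 - r) ^ (N + 1 - j) *
              ((j : ℝ) - (N + 1 : ℕ) * r) : ℝ) : ℂ) := by
            push_cast; ring
          rw [norm_mul, e2, Complex.norm_real, Real.norm_eq_abs, abs_mul,
            abs_of_nonneg (by positivity : 0 ≤ ((N + 1).choose j * r ^ j * (1 - r) ^ (N + 1 - j)))]
          gcongr
          exact hB _ _ (by simp at hj; omega)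
      _ ≤ _ := by
          rw [← Finset.sum_mul]
          refine mul_le_mul_of_nonneg_right ?_ hB0
          refine (sum_binomial_mul_abs_deviation_le hr0.le hr1.le (N + 1)).trans (le_of_eq ?_)
          push_cast
          rw [mul_assoc]
  have hs : 0 < √(((N : ℝ) + 1) * (r * (1 - r))) := Real.sqrt_pos.2 hc
  have hss := Real.mul_self_sqrt hc.le
  rw [le_div_iff₀ hs]
  rw [mul_comm]
  refine le_of_mul_le_mul_left ?_ hs
  rwa [← mul_assoc, hss]

/-- The difference operator along the antidiagonals of `ℕ × ℕ`. -/
def antidiagDiff (F : ℕ → ℕ → ℂ) : ℕ → ℕ → ℂ := fun k n => F k (n + 1) - F (k + 1) n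

theorem IsHarmonic.iterate {x y : ℂ} {F : ℕ → ℕ → ℂ} (h : IsHarmonic x y F) (M : ℕ) :
    IsHarmonic x y (antidiagDiff^[M] F) := by
  induction M with
  | zero => exact h
  | succ M ih => rw [Function.iterate_succ_apply']; exact ih.diff

/-- Taking `N = n` steps at height `n` only reaches heights at most `2n + 1`, so the bound on `F`
worsens by a constant while the gain is of order `√(1 + n)`. -/
theorem IsHarmonic.diff_growth {r : ℝ} {F : ℕ → ℕ → ℂ}
    (h : IsHarmonic r (1 - r : ℝ) F) (hr0 : 0 < r) (hr1 : r < 1) {s : ℕ} {C : ℝ}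
    (hF : ∀ k n, ‖F k n‖ ≤ C * √(1 + n) ^ (s + 1)) :
    ∃ C', ∀ k n, ‖antidiagDiff F k n‖ ≤ C' * √(1 + n) ^ s := by
  have hr2 : 0 < 1 - r := by linarith
  have hC : 0 ≤ C := by simpa using (norm_nonneg _).trans (hF 0 0)
  refine ⟨C * √2 ^ (s + 1) / √(r * (1 - r)), fun k n => ?_⟩
  have hn : (0 : ℝ) < 1 + n := by positivity
  have h1 := h.norm_diff_le hr0 hr1 (N := n) (k := k) (n := n)
    (B := C * √(2 * (1 + n)) ^ (s + 1)) (by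
      intro l j hj
      refine (hF _ _).trans ?_
      have : (j : ℝ) ≤ n + 1 := by exact_mod_cast hj
      gcongr
      push_cast
      linarith)
  refine h1.trans (le_of_eq ?_)
  have : √(1 + (n : ℝ)) ≠ 0 := (Real.sqrt_pos.2 hn).ne'
  have : √(r * (1 - r)) ≠ 0 := (Real.sqrt_pos.2 (by positivity)).ne'
  rw [add_comm (n : ℝ) 1, Real.sqrt_mul hn.le, Real.sqrt_mul (by norm_num), mul_pow]
  field_simp
  ring

/-- Liouville's theorem for bounded harmonic functions. -/
theorem IsHarmonic.diff_eq_zero_of_bounded {r : ℝ} {F : ℕ → ℕ → ℂ}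
    (h : IsHarmonic r (1 - r : ℝ) F) (hr0 : 0 < r) (hr1 : r < 1) {C : ℝ}
    (hF : ∀ k n, ‖F k n‖ ≤ C) : antidiagDiff F = 0 := by
  have hr2 : 0 < 1 - r := by linarith
  funext k n
  have h1 : ∀ N : ℕ, ‖antidiagDiff F k n‖ ≤ C / √((N + 1) * (r * (1 - r))) := fun N =>
    h.norm_diff_le hr0 hr1 (fun l j _ => hF _ _)
  have h2 : Tendsto (fun N : ℕ => C / √(((N : ℝ) + 1) * (r * (1 - r)))) atTop (𝓝 0) := by
    refine tendsto_const_nhds.div_atTop (Real.tendsto_sqrt_atTop.comp ?_)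
    exact (tendsto_atTop_add_const_right _ _ tendsto_natCast_atTop_atTop).atTop_mul_const
      (by positivity)
  exact norm_le_zero_iff.1 (ge_of_tendsto' h2 h1)

theorem IsHarmonic.exists_iterate_diff_eq_zero {r : ℝ} {F : ℕ → ℕ → ℂ}
    (h : IsHarmonic r (1 - r : ℝ) F) (hr0 : 0 < r) (hr1 : r < 1) {s : ℕ} {C : ℝ}
    (hF : ∀ k n, ‖F k n‖ ≤ C * √(1 + n) ^ s) :
    antidiagDiff^[s + 1] F = 0 := by
  induction s generalizing F C with
  | zero => exact h.diff_eq_zero_of_bounded hr0 hr1 (C := C) (by simpa using hF)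
  | succ s ih =>
    obtain ⟨C', hC'⟩ := h.diff_growth hr0 hr1 hF
    rw [Function.iterate_succ_apply]
    exact ih h.diff hC'

theorem iterate_antidiagDiff_bounded {F : ℕ → ℕ → ℂ} (hF : ∀ n, ∃ C, ∀ k, ‖F k n‖ ≤ C) (M : ℕ) :
    ∀ n, ∃ C, ∀ k, ‖antidiagDiff^[M] F k n‖ ≤ C := by
  induction M with
  | zero => exact hF
  | succ M ih =>
    intro n
    obtain ⟨C₁, h₁⟩ := ih n
    obtain ⟨C₂, h₂⟩ := ih (n + 1)
    refine ⟨C₂ + C₁, fun k => ?_⟩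
    rw [Function.iterate_succ_apply']
    exact (norm_sub_le _ _).trans (add_le_add (h₂ _) (h₁ _))

/-- Harmonicity reads `F(k+1, n) = F(k, n) - r DF(k, n)`, with `D` the antidiagonal difference.
Applied to `DF`, it makes `DF` independent of `k`; then `F` is affine in `k`, and boundedness forces
slope zero. -/
theorem IsHarmonic.diff_eq_zero_of_diff_diff {r : ℝ} {F : ℕ → ℕ → ℂ}
    (h : IsHarmonic r (1 - r : ℝ) F) (hr0 : 0 < r) (hF : ∀ n, ∃ C, ∀ k, ‖F k n‖ ≤ C)
    (h2 : antidiagDiff (antidiagDiff F) = 0) : antidiagDiff F = 0 := by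
  have hstep : ∀ {H : ℕ → ℕ → ℂ}, IsHarmonic r (1 - r : ℝ) H → ∀ k n,
      H (k + 1) n = H k n - r * antidiagDiff H k n := by
    intro H hH k n
    have := hH k n
    push_cast at this
    unfold antidiagDiff
    linear_combination -this
  have hconst : ∀ k n, antidiagDiff F k n = antidiagDiff F 0 n := by
    intro k n
    induction k with
    | zero => rfl
    | succ k ih => rw [hstep (H := antidiagDiff F) h.diff, h2, ih]; simp
  have hlin : ∀ k n, F k n = F 0 n - k * (r * antidiagDiff F 0 n) := by
    intro k n
    induction k with
    | zero => simp
    | succ k ih => rw [hstep h, ih, hconst k]; push_cast; ring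
  funext k n
  rw [hconst]
  obtain ⟨C, hC⟩ := hF n
  have h3 : ∀ j : ℕ, ‖(r * antidiagDiff F 0 n : ℂ)‖ ≤ 2 * C / ((j : ℝ) + 1) := by
    intro j
    rw [le_div_iff₀ (by positivity)]
    have e : ((j + 1 : ℕ) : ℂ) * (r * antidiagDiff F 0 n) = F 0 n - F (j + 1) n := by
      rw [hlin (j + 1) n]; ring
    have e2 := congrArg norm e
    rw [norm_mul, Complex.norm_natCast] at e2
    push_cast at e2
    rw [mul_comm, e2]
    refine (norm_sub_le _ _).trans ?_
    linarith [hC 0, hC (j + 1)]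
  have h4 : Tendsto (fun j : ℕ => 2 * C / ((j : ℝ) + 1)) atTop (𝓝 0) :=
    tendsto_const_nhds.div_atTop
      (tendsto_atTop_add_const_right _ _ tendsto_natCast_atTop_atTop)
  have h5 := norm_le_zero_iff.1 (ge_of_tendsto' h4 h3)
  exact (mul_eq_zero.1 h5).resolve_left (by exact_mod_cast hr0.ne')

/-- Liouville's theorem for harmonic functions on `ℕ × ℕ` that are bounded in the first variable
and of polynomial growth in the second one. -/
theorem IsHarmonic.diff_eq_zero {r : ℝ} {F : ℕ → ℕ → ℂ}
    (h : IsHarmonic r (1 - r : ℝ) F) (hr0 : 0 < r) (hr1 : r < 1) {s : ℕ} {C : ℝ}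
    (hF : ∀ k n, ‖F k n‖ ≤ C * (1 + n) ^ s) : antidiagDiff F = 0 := by
  have hz := h.exists_iterate_diff_eq_zero hr0 hr1 (s := 2 * s) (C := C) (by
    intro k n
    rw [pow_mul, Real.sq_sqrt (by positivity)]
    exact hF k n)
  have hb : ∀ n, ∃ C, ∀ k, ‖F k n‖ ≤ C := fun n => ⟨_, fun k => hF k n⟩
  -- The growth exponent has done its work: from `D^(M+1) F = 0` the order of vanishing is lowered
  -- to one using boundedness in `k` alone.
  generalize 2 * s = M at hz
  induction M with
  | zero => exact hz
  | succ M ih =>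
    refine ih ?_
    rw [Function.iterate_succ_apply']
    refine (h.iterate M).diff_eq_zero_of_diff_diff hr0 (iterate_antidiagDiff_bounded hb M) ?_
    rw [← Function.iterate_succ_apply' antidiagDiff, ← Function.iterate_succ_apply' antidiagDiff]
    exact hz

/-! ### Radial sums on the tree and the norm of the averaging operator. -/

/-- In a tree, a vertex other than the root has a unique neighbour that is closer to the root. -/
theorem SimpleGraph.IsTree.exists_parent {X : Type*} {G : SimpleGraph X} (hG : G.IsTree) {o x : X}
    (hx : x ≠ o) : ∃ z, G.Adj x z ∧ G.dist o x = G.dist o z + 1 ∧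
      ∀ y, G.Adj x y → y ≠ z → G.dist o y = G.dist o x + 1 := by
  obtain ⟨w, hw, hwl⟩ := hG.connected.exists_path_of_dist o x
  have hnil : ¬ w.Nil := SimpleGraph.Walk.not_nil_of_ne hx.symm
  have huniq : ∀ y, G.Adj x y → y ≠ w.penultimate → G.dist o y = G.dist o x + 1 := by
    intro y hy hne
    refine (hG.dist_eq_dist_add_one_of_adj o hy).resolve_left fun hd => hne ?_
    -- The geodesic to a closer neighbour `y` is too short to meet `x`; by acyclicity `y` then lies
    -- on `w`, necessarily next to last.
    obtain ⟨v, hv, hvl⟩ := hG.connected.exists_path_of_dist o y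
    refine hG.isAcyclic.eq_penultimate_of_adj_end hw hy ?_
    refine hG.isAcyclic.mem_support_of_ne_mem_support_of_adj_of_isPath hw hv hy fun hmem => ?_
    classical
    have h1 := SimpleGraph.dist_le (v.takeUntil x hmem)
    have h2 := v.length_takeUntil_le_length hmem
    omega
  have hadj := (w.adj_penultimate hnil).symm
  refine ⟨w.penultimate, hadj, ?_, huniq⟩
  refine (hG.dist_eq_dist_add_one_of_adj o hadj).resolve_right fun hd => ?_
  have h1 := SimpleGraph.dist_le w.dropLast
  have h2 := w.length_dropLast_add_one hnil
  omega

namespace HomTree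

variable {X : Type*} {G : SimpleGraph X} {q : ℕ}

theorem IsHomogeneousTree.sum_radial_root [G.LocallyFinite] (hG : IsHomogeneousTree G q) {o : X} {E : Type*}
    [AddCommMonoid E] (h : ℕ → E) : ∑ y ∈ G.neighborFinset o, h (G.dist o y) = (q + 1) • h 1 := by
  rw [Finset.sum_congr rfl fun y hy => by
    rw [SimpleGraph.dist_eq_one_iff_adj.2 ((G.mem_neighborFinset o y).1 hy)]]
  rw [Finset.sum_const, SimpleGraph.card_neighborFinset_eq_degree, hG.degree_eq]

theorem IsHomogeneousTree.sum_radial [G.LocallyFinite] (hG : IsHomogeneousTree G q) {o x : X} {l : ℕ}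
    (hx : G.dist o x = l + 1) {E : Type*} [AddCommMonoid E] (h : ℕ → E) :
    ∑ y ∈ G.neighborFinset x, h (G.dist o y) = q • h (l + 2) + h l := by
  classical
  have hne : x ≠ o := by rintro rfl; simp at hx
  obtain ⟨z, hz, hd, hu⟩ := hG.isTree.exists_parent hne
  have hmem : z ∈ G.neighborFinset x := by simpa using hz
  have hc : (G.neighborFinset x).card = q + 1 := by
    rw [SimpleGraph.card_neighborFinset_eq_degree, hG.degree_eq]
  rw [← Finset.sum_erase_add _ _ hmem]
  have hzl : G.dist o z = l := by omega
  have hs : ∀ y ∈ (G.neighborFinset x).erase z, h (G.dist o y) = h (l + 2) := by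
    intro y hy
    rw [Finset.mem_erase, SimpleGraph.mem_neighborFinset] at hy
    rw [hu y hy.2 hy.1, hx]
  rw [hzl, Finset.sum_congr rfl hs, Finset.sum_const, Finset.card_erase_of_mem hmem, hc]
  rfl

/-- `t ^ |x|` is superharmonic up to the factor `(q t + t⁻¹) / (q + 1)`. -/
theorem IsHomogeneousTree.sum_pow_dist_le [G.LocallyFinite] (hG : IsHomogeneousTree G q) (o x : X) {t : ℝ}
    (ht0 : 0 < t) (ht1 : t ≤ 1) :
    ∑ y ∈ G.neighborFinset x, t ^ G.dist o y ≤ (q * t + t⁻¹) * t ^ G.dist o x := by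
  rcases eq_or_ne x o with rfl | hne
  · rw [hG.sum_radial_root (fun n => t ^ n)]
    have : t ≤ t⁻¹ := ht1.trans ((one_le_inv₀ ht0).2 ht1)
    simp
    linarith
  · obtain ⟨z, -, hd, -⟩ := hG.isTree.exists_parent hne
    rw [hG.sum_radial hd (fun n => t ^ n), hd]
    refine le_of_eq ?_
    simp only [nsmul_eq_mul]
    field_simp
    ring

/-- The averaging operator `1 - 𝓛` on the Schwartz space. -/
noncomputable def average [G.LocallyFinite] (hG : IsHomogeneousTree G q) (o : X) (p : ℝ) :
    schwartz G q o p →ₗ[ℂ] schwartz G q o p :=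
  LinearMap.id - laplacianSchwartz hG o p

theorem average_apply [G.LocallyFinite] (hG : IsHomogeneousTree G q) {o : X} {p : ℝ} (f : schwartz G q o p) (x : X) :
    (average hG o p f).1 x = (1 / ((q : ℂ) + 1)) * ∑ y ∈ G.neighborFinset x, f.1 y := by
  simp [average, laplacianSchwartz, laplacian]

/-- The norm of the averaging operator. -/
noncomputable def rate (q : ℕ) (p : ℝ) : ℝ := (q * (q : ℝ) ^ (-(1 / p)) + ((q : ℝ) ^ (-(1 / p)))⁻¹) / (q + 1)

/-- A neighbour of `x` is at most one step closer to the root, so the antitone factor `h` can be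
pulled out of the sum at the price of one shift; the remaining `t^|y|` sum to at most `(q + 1) ρ
t^|x|`. -/
theorem norm_average_le [G.LocallyFinite] (hG : IsHomogeneousTree G q) {o : X} {p : ℝ} (hp : 0 < p)
    {f : schwartz G q o p} {K : ℝ} (hK : 0 ≤ K) {h : ℕ → ℝ} (hh : Antitone h) (hh0 : ∀ n, 0 ≤ h n)
    {n : ℕ} (hf : ∀ x, ‖f.1 x‖ ≤ K * ((q : ℝ) ^ (-(1 / p))) ^ G.dist o x * h (G.dist o x - n))
    (x : X) : ‖(average hG o p f).1 x‖ ≤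
      K * rate q p * ((q : ℝ) ^ (-(1 / p))) ^ G.dist o x * h (G.dist o x - (n + 1)) := by
  have hq : (1 : ℝ) ≤ q := by exact_mod_cast le_trans (by norm_num) hG.two_le
  have hq0 : (0 : ℝ) < (q : ℝ) + 1 := by positivity
  set t : ℝ := (q : ℝ) ^ (-(1 / p)) with ht
  have ht0 : 0 < t := Real.rpow_pos_of_pos (by linarith) _
  have ht1 : t ≤ 1 := Real.rpow_le_one_of_one_le_of_nonpos hq (by
    have : 0 < 1 / p := by positivity
    linarith)
  have hn : ‖(1 / ((q : ℂ) + 1))‖ = 1 / ((q : ℝ) + 1) := by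
    rw [norm_div, norm_one, ← Nat.cast_add_one, Complex.norm_natCast, Nat.cast_add_one]
  rw [average_apply, norm_mul, hn]
  have h1 : ‖∑ y ∈ G.neighborFinset x, f.1 y‖ ≤
      K * h (G.dist o x - (n + 1)) * ((q * t + t⁻¹) * t ^ G.dist o x) := by
    refine le_trans ?_ (mul_le_mul_of_nonneg_left (hG.sum_pow_dist_le o x ht0 ht1)
      (mul_nonneg hK (hh0 _)))
    rw [Finset.mul_sum]
    refine norm_sum_le_of_le _ fun y hy => (hf y).trans ?_
    have hd : G.dist o x ≤ G.dist o y + 1 :=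
      dist_le_of_adj hG.isTree.connected o (by simpa using hy)
    have hle : h (G.dist o y - n) ≤ h (G.dist o x - (n + 1)) := hh (by omega)
    calc K * t ^ G.dist o y * h (G.dist o y - n)
        ≤ K * t ^ G.dist o y * h (G.dist o x - (n + 1)) := by gcongr
      _ = _ := by ring
  calc 1 / ((q : ℝ) + 1) * ‖∑ y ∈ G.neighborFinset x, f.1 y‖
      ≤ 1 / ((q : ℝ) + 1) *
        (K * h (G.dist o x - (n + 1)) * ((q * t + t⁻¹) * t ^ G.dist o x)) := by gcongr
    _ = _ := by unfold rate; rw [← ht]; ring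

theorem rate_pos (hq : 2 ≤ q) (p : ℝ) : 0 < rate q p := by
  have : (0 : ℝ) < q := by exact_mod_cast (by omega : 0 < q)
  unfold rate
  positivity

theorem norm_average_pow_le [G.LocallyFinite] (hG : IsHomogeneousTree G q) {o : X} {p : ℝ} (hp : 0 < p)
    {f : schwartz G q o p} {K : ℝ} (hK : 0 ≤ K) {h : ℕ → ℝ} (hh : Antitone h) (hh0 : ∀ n, 0 ≤ h n)
    (hf : ∀ x, ‖f.1 x‖ ≤ K * ((q : ℝ) ^ (-(1 / p))) ^ G.dist o x * h (G.dist o x)) (n : ℕ) (x : X) :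
    ‖((average hG o p ^ n) f).1 x‖ ≤
      K * rate q p ^ n * ((q : ℝ) ^ (-(1 / p))) ^ G.dist o x * h (G.dist o x - n) := by
  induction n generalizing x with
  | zero => simpa using hf x
  | succ n ih =>
    rw [pow_succ', Module.End.mul_apply, pow_succ, ← mul_assoc K]
    exact norm_average_le hG hp (mul_nonneg hK (pow_nonneg (rate_pos hG.two_le p).le n)) hh hh0 ih x

theorem weight_eq (hq : 2 ≤ q) (o : X) (p : ℝ) (m : ℕ) (x : X) :
    weight G q o p m x = (1 + (G.dist o x : ℝ)) ^ m * (((q : ℝ) ^ (-(1 / p))) ^ G.dist o x)⁻¹ := by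
  have : (0 : ℝ) < q := by exact_mod_cast (by omega : 0 < q)
  unfold weight
  rw [← Real.rpow_natCast, ← Real.rpow_natCast, ← Real.rpow_mul this.le, ← Real.rpow_neg this.le]
  congr 2
  ring

theorem le_nu {o : X} {p : ℝ} (m : ℕ) (f : schwartz G q o p) (x : X) :
    weight G q o p m x * ‖f.1 x‖ ≤ nu G q o p m f :=
  le_ciSup (f.2 m) x

theorem nu_le {o : X} {p : ℝ} {m : ℕ} {f : schwartz G q o p} {C : ℝ}
    (h : ∀ x, weight G q o p m x * ‖f.1 x‖ ≤ C) : nu G q o p m f ≤ C :=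
  haveI : Nonempty X := ⟨o⟩
  ciSup_le h

theorem nu_mono {o : X} {p : ℝ} {m n : ℕ} (h : m ≤ n) (f : schwartz G q o p) :
    nu G q o p m f ≤ nu G q o p n f := by
  refine nu_le fun x => le_trans ?_ (le_nu n f x)
  unfold weight
  gcongr
  have : (0 : ℝ) ≤ G.dist o x := by positivity
  linarith

theorem norm_le_nu (hq : 2 ≤ q) {o : X} {p : ℝ} (m : ℕ) (f : schwartz G q o p) (x : X) :
    ‖f.1 x‖ ≤ nu G q o p m f * ((q : ℝ) ^ (-(1 / p))) ^ G.dist o x *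
      ((1 + (G.dist o x : ℝ)) ^ m)⁻¹ := by
  have : (0 : ℝ) < q := by exact_mod_cast (by omega : 0 < q)
  have h1 := le_nu m f x
  rw [weight_eq hq] at h1
  have h2 : 0 < ((q : ℝ) ^ (-(1 / p))) ^ G.dist o x := by positivity
  have h3 : 0 < (1 + (G.dist o x : ℝ)) ^ m := by positivity
  calc ‖f.1 x‖ = ((1 + (G.dist o x : ℝ)) ^ m * (((q : ℝ) ^ (-(1 / p))) ^ G.dist o x)⁻¹ * ‖f.1 x‖) *
        (((q : ℝ) ^ (-(1 / p))) ^ G.dist o x * ((1 + (G.dist o x : ℝ)) ^ m)⁻¹) := by field_simp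
    _ ≤ nu G q o p m f * (((q : ℝ) ^ (-(1 / p))) ^ G.dist o x * ((1 + (G.dist o x : ℝ)) ^ m)⁻¹) := by
        gcongr
    _ = _ := by ring

/-- With `h(l) = (1 + l)^(-m)`, the `n` shifts cost only `(1 + n)^m`, because `1 + l ≤ (1 + n)(1 +
(l - n))` with truncated subtraction; the exponential rate stays exactly `ρ`. -/
theorem nu_average_pow_le [G.LocallyFinite] (hG : IsHomogeneousTree G q) {o : X} {p : ℝ} (hp : 0 < p) (m n : ℕ)
    (f : schwartz G q o p) :
    nu G q o p m ((average hG o p ^ n) f) ≤ nu G q o p m f * ((1 + n) ^ m * rate q p ^ n) := by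
  refine nu_le fun x => ?_
  have hq : (0 : ℝ) < q := by exact_mod_cast lt_of_lt_of_le (by norm_num) hG.two_le
  have h1 := norm_average_pow_le hG hp (apply_nonneg (nu G q o p m) f)
    (h := fun l : ℕ => ((1 + (l : ℝ)) ^ m)⁻¹) (fun a b hab => by dsimp only; gcongr)
    (fun l => by positivity) (norm_le_nu hG.two_le m f) n x
  have hr := rate_pos hG.two_le p
  rw [weight_eq hG.two_le]
  set l := G.dist o x
  set t : ℝ := (q : ℝ) ^ (-(1 / p))
  have ht : 0 < t := Real.rpow_pos_of_pos hq _
  have hl : (1 + (l : ℝ)) ^ m ≤ (1 + n) ^ m * (1 + ((l - n : ℕ) : ℝ)) ^ m := by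
    rw [← mul_pow]
    refine pow_le_pow_left₀ (by positivity) ?_ m
    have : (l : ℝ) ≤ n + (l - n : ℕ) := by exact_mod_cast (by omega : l ≤ n + (l - n))
    nlinarith [Nat.cast_nonneg (α := ℝ) n, Nat.cast_nonneg (α := ℝ) (l - n)]
  have hd : 0 < (1 + ((l - n : ℕ) : ℝ)) ^ m := by positivity
  have hnu := apply_nonneg (nu G q o p m) f
  calc _ ≤ ((1 + n) ^ m * (1 + ((l - n : ℕ) : ℝ)) ^ m) * (t ^ l)⁻¹ *
        (nu G q o p m f * rate q p ^ n * t ^ l * ((1 + ((l - n : ℕ) : ℝ)) ^ m)⁻¹) := by gcongr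
    _ = _ := by field_simp

/-- A continuous seminorm is dominated by one of the defining seminorms. -/
theorem IsContinuousSeminorm.exists_le {o : X} {p : ℝ} {ν : Seminorm ℂ (schwartz G q o p)}
    (hν : IsContinuousSeminorm ν) : ∃ m : ℕ, ∀ f, ν f ≤ ((m : ℝ) + 1) * nu G q o p m f := by
  by_contra! hcon
  -- Using `m` both as index and as constant, failure yields a single sequence; scaled to `ν = 1` it
  -- tends to zero, as `ν_m ≤ ν_n ≤ 1/(n + 1)` for `n ≥ m`.
  choose f hf using hcon
  have hpos : ∀ n, 0 < ν (f n) := fun n =>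
    lt_of_le_of_lt (mul_nonneg (by positivity) (apply_nonneg _ _)) (hf n)
  have h1 : ∀ n, ν (((ν (f n) : ℂ)⁻¹) • f n) = 1 := by
    intro n
    rw [map_smul_eq_mul, norm_inv, Complex.norm_real, Real.norm_of_nonneg (hpos n).le,
      inv_mul_cancel₀ (hpos n).ne']
  have h2 : TendstoZero G q o p fun n => ((ν (f n) : ℂ)⁻¹) • f n := by
    intro m
    refine squeeze_zero' (.of_forall fun n => apply_nonneg _ _) ?_
      tendsto_one_div_add_atTop_nhds_zero_nat
    filter_upwards [eventually_ge_atTop m] with n hn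
    refine (nu_mono hn _).trans ?_
    rw [map_smul_eq_mul, norm_inv, Complex.norm_real, Real.norm_of_nonneg (hpos n).le,
      inv_mul_le_iff₀ (hpos n), mul_one_div, le_div_iff₀ (by positivity), mul_comm]
    exact (hf n).le
  have h3 := hν _ h2
  simp only [h1] at h3
  exact one_ne_zero (tendsto_nhds_unique tendsto_const_nhds h3)

/-! ### Parts (b) and (a). -/

theorem IsRoeSequence.exists_bound [G.LocallyFinite] {hG : IsHomogeneousTree G q} {o : X} {p : ℝ} {lam : ℂ}
    {T : ℕ → (schwartz G q o p →ₗ[ℂ] ℂ)} (hT : IsRoeSequence hG lam T) :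
    ∃ (m : ℕ) (C : ℝ), 0 ≤ C ∧ ∀ k φ, ‖T k φ‖ ≤ C * nu G q o p m φ := by
  obtain ⟨ν, hν, M, hM, h⟩ := hT.bounded
  obtain ⟨m, hm⟩ := hν.exists_le
  refine ⟨m, M * (m + 1), by positivity, fun k φ => (h k φ).trans ?_⟩
  rw [mul_assoc]
  exact mul_le_mul_of_nonneg_left (hm φ) hM.le

theorem IsRoeSequence.apply_average [G.LocallyFinite] {hG : IsHomogeneousTree G q} {o : X} {p : ℝ} {lam : ℂ}
    {T : ℕ → (schwartz G q o p →ₗ[ℂ] ℂ)} (hT : IsRoeSequence hG lam T) (k : ℕ)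
    (φ : schwartz G q o p) : T k φ = T k (average hG o p φ) + lam * T (k + 1) φ := by
  have h := congrArg (fun S => S φ) (hT.laplacian_eq k)
  simp only [laplacianDist, LinearMap.comp_apply, LinearMap.smul_apply, smul_eq_mul] at h
  rw [← h, average, LinearMap.sub_apply, map_sub]
  simp

theorem IsRoeSequence.eq_zero [G.LocallyFinite] {hG : IsHomogeneousTree G q} {o : X} {p : ℝ} (hp : 0 < p) {lam : ℂ}
    {T : ℕ → (schwartz G q o p →ₗ[ℂ] ℂ)} (hT : IsRoeSequence hG lam T)
    (hlam : rate q p + ‖lam‖ < 1) (k : ℕ) : T k = 0 := by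
  obtain ⟨m, C, hC, hb⟩ := hT.exists_bound
  have hr := rate_pos hG.two_le p
  ext ψ
  have hH : IsHarmonic 1 lam fun k n => T k ((average hG o p ^ n) ψ) := by
    intro k n
    dsimp only
    rw [one_mul, pow_succ', Module.End.mul_apply]
    exact hT.apply_average k _
  -- After `N` steps the factors `|λ|^(N-j)` and `ρ^j` recombine to `(ρ + |λ|)^N`; the polynomial
  -- losses are at most `(N + 1)^m`.
  have hbound : ∀ N : ℕ, ‖T k ψ‖ ≤
      C * nu G q o p m ψ * (((N + 1 : ℕ) : ℝ) ^ m * (rate q p + ‖lam‖) ^ N) := by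
    intro N
    have h0 := hH.eq_sum N k 0
    simp only [pow_zero, Module.End.one_apply, one_pow, mul_one, zero_add] at h0
    rw [h0, add_pow, Finset.mul_sum, Finset.mul_sum]
    refine norm_sum_le_of_le _ fun j hj => ?_
    have hj' : (j : ℝ) ≤ N := by
      exact_mod_cast Nat.lt_succ_iff.1 (Finset.mem_range.1 hj)
    have hnu := apply_nonneg (nu G q o p m) ψ
    rw [norm_mul, norm_mul, norm_pow, Complex.norm_natCast]
    calc (N.choose j : ℝ) * ‖lam‖ ^ (N - j) * ‖T (k + (N - j)) ((average hG o p ^ j) ψ)‖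
        ≤ (N.choose j : ℝ) * ‖lam‖ ^ (N - j) *
          (C * (nu G q o p m ψ * ((1 + j) ^ m * rate q p ^ j))) := by
          gcongr
          exact (hb _ _).trans (mul_le_mul_of_nonneg_left (nu_average_pow_le hG hp m j ψ) hC)
      _ ≤ (N.choose j : ℝ) * ‖lam‖ ^ (N - j) *
          (C * (nu G q o p m ψ * ((1 + N) ^ m * rate q p ^ j))) := by gcongr
      _ = _ := by push_cast; ring
  have hlim : Tendsto (fun N : ℕ => C * nu G q o p m ψ *
      (((N + 1 : ℕ) : ℝ) ^ m * (rate q p + ‖lam‖) ^ N)) atTop (𝓝 0) := by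
    have hs : 0 < rate q p + ‖lam‖ := by positivity
    have h1 := (tendsto_add_atTop_iff_nat 1).2
      (tendsto_pow_const_mul_const_pow_of_abs_lt_one m (r := rate q p + ‖lam‖)
        (by rwa [abs_of_pos hs]))
    have h2 := h1.const_mul (C * nu G q o p m ψ * (rate q p + ‖lam‖)⁻¹)
    rw [mul_zero] at h2
    refine h2.congr fun N => ?_
    rw [pow_succ]
    field_simp
  exact norm_le_zero_iff.1 (ge_of_tendsto' hlim hbound)

theorem IsRoeSequence.laplacianDist_eq [G.LocallyFinite] {hG : IsHomogeneousTree G q} {o : X} {p : ℝ} (hp : 0 < p)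
    {lam : ℂ} (hlam0 : lam ≠ 0) {T : ℕ → (schwartz G q o p →ₗ[ℂ] ℂ)} (hT : IsRoeSequence hG lam T)
    (hlam : ‖lam‖ = 1 - rate q p) : laplacianDist hG (T 0) = (‖lam‖ : ℂ) • T 0 := by
  obtain ⟨m, C, hC, hb⟩ := hT.exists_bound
  have hr := rate_pos hG.two_le p
  have hg : 0 < 1 - rate q p := by rw [← hlam]; positivity
  have hgc : ((1 - rate q p : ℝ) : ℂ) ≠ 0 := by exact_mod_cast hg.ne'
  have hrc : (rate q p : ℂ) ≠ 0 := by exact_mod_cast hr.ne'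
  -- The phase of `λ`; the factor `θ^k` turns the weight `λ` into the probability `1 - ρ` without
  -- changing norms.
  set θ : ℂ := lam / (1 - rate q p : ℝ) with hθ
  have hθ1 : ‖θ‖ = 1 := by
    rw [hθ, norm_div, Complex.norm_real, hlam, Real.norm_of_nonneg hg.le, div_self hg.ne']
  have hθlam : ((1 - rate q p : ℝ) : ℂ) * θ = lam := by rw [hθ]; field_simp
  rw [hT.laplacian_eq 0]
  ext ψ
  set F : ℕ → ℕ → ℂ := fun k n => θ ^ k * (((rate q p : ℂ) ^ n)⁻¹ * T k ((average hG o p ^ n) ψ))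
    with hF
  have hH : IsHarmonic (rate q p) (1 - rate q p : ℝ) F := by
    intro k n
    have h1 := hT.apply_average k ((average hG o p ^ n) ψ)
    rw [← Module.End.mul_apply, ← pow_succ'] at h1
    simp only [hF]
    generalize (average hG o p ^ (n + 1)) ψ = φ at h1 ⊢
    rw [h1, ← hθlam, pow_succ (rate q p : ℂ) n, pow_succ θ k]
    field_simp
  have hFb : ∀ k n, ‖F k n‖ ≤ C * nu G q o p m ψ * (1 + n) ^ m := by
    intro k n
    rw [norm_mul, norm_pow, hθ1, one_pow, one_mul, norm_mul, norm_inv, norm_pow, Complex.norm_real,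
      Real.norm_of_nonneg hr.le]
    calc _ ≤ (rate q p ^ n)⁻¹ * (C * (nu G q o p m ψ * ((1 + n) ^ m * rate q p ^ n))) := by
          gcongr
          exact (hb _ _).trans (mul_le_mul_of_nonneg_left (nu_average_pow_le hG hp m n ψ) hC)
      _ = _ := by field_simp
  have hD := congrFun (congrFun (hH.diff_eq_zero hr (by linarith) hFb) 0) 0
  have hF0 := hH 0 0
  simp only [antidiagDiff, Pi.zero_apply] at hD
  -- `F(0, 0)` is an average of two values that Liouville's theorem makes equal; the identity says
  -- `T_0 ψ = θ T_1 ψ`.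
  have h01 : F 0 0 = F 1 0 := by
    push_cast at hF0
    linear_combination hF0 + (rate q p : ℂ) * hD
  simp only [hF, pow_zero, one_mul, inv_one, pow_one, Module.End.one_apply] at h01
  rw [LinearMap.smul_apply, LinearMap.smul_apply, hlam, h01, ← hθlam, smul_eq_mul, smul_eq_mul]
  ring

end HomTree

/-! ### Sphere sizes and distributions given by functions. -/

namespace HomTree

variable {X : Type*} {G : SimpleGraph X} {q : ℕ}

/-- A set of vertices at distance `n + 1` from the root has at most `(q + 1) q ^ n` elements. -/
theorem IsHomogeneousTree.card_le_of_dist_eq_succ [G.LocallyFinite] (hG : IsHomogeneousTree G q)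
    {o : X} (n : ℕ) (s : Finset X) (hs : ∀ x ∈ s, G.dist o x = n + 1) :
    s.card ≤ (q + 1) * q ^ n := by
  classical
  have hdeg : ∀ x, (G.neighborFinset x).card = q + 1 := fun x => by
    rw [SimpleGraph.card_neighborFinset_eq_degree, hG.degree_eq]
  induction n generalizing s with
  | zero =>
    rw [pow_zero, mul_one, ← hdeg o]
    refine Finset.card_le_card fun x hx => ?_
    rw [SimpleGraph.mem_neighborFinset, ← SimpleGraph.dist_eq_one_iff_adj, hs x hx]
  | succ n ih =>
    have hpar : ∀ x, ∃ z, G.dist o x ≠ 0 → G.Adj x z ∧ G.dist o x = G.dist o z + 1 := by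
      intro x
      rcases eq_or_ne x o with rfl | hne
      · exact ⟨x, fun h => absurd SimpleGraph.dist_self h⟩
      · obtain ⟨z, h1, h2, -⟩ := hG.isTree.exists_parent hne
        exact ⟨z, fun _ => ⟨h1, h2⟩⟩
    choose par hpar using hpar
    -- A fibre of `par` lies among the `q + 1` neighbours of the common parent, without that
    -- vertex's own parent.
    have h1 : s.card ≤ q * (s.image par).card := by
      refine Finset.card_le_mul_card_image s q fun z hz => ?_
      obtain ⟨x, hx, rfl⟩ := Finset.mem_image.1 hz
      have hx2 := hpar x (by rw [hs x hx]; omega)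
      have hx3 := hs x hx
      have hz2 := hpar (par x) (by omega)
      have hmem : par (par x) ∈ G.neighborFinset (par x) := by simpa using hz2.1
      have hc : ((G.neighborFinset (par x)).erase (par (par x))).card = q := by
        rw [Finset.card_erase_of_mem hmem, hdeg]; rfl
      rw [← hc]
      refine Finset.card_le_card fun y hy => ?_
      obtain ⟨hys, hyp⟩ := Finset.mem_filter.1 hy
      have hy3 := hs y hys
      have hy2 := hpar y (by omega)
      rw [hyp] at hy2
      rw [Finset.mem_erase, SimpleGraph.mem_neighborFinset]
      refine ⟨?_, hy2.1.symm⟩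
      rintro rfl
      omega
    have h2 := ih (s.image par) (by
      intro z hz
      obtain ⟨x, hx, rfl⟩ := Finset.mem_image.1 hz
      have hx3 := hs x hx
      have hx2 := hpar x (by omega)
      omega)
    calc s.card ≤ q * (s.image par).card := h1
      _ ≤ q * ((q + 1) * q ^ n) := by gcongr
      _ = _ := by ring

theorem IsHomogeneousTree.card_le_of_dist_eq [G.LocallyFinite] (hG : IsHomogeneousTree G q)
    {o : X} (n : ℕ) (s : Finset X) (hs : ∀ x ∈ s, G.dist o x = n) :
    s.card ≤ (q + 1) * q ^ n := by
  have hq := hG.two_le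
  cases n with
  | zero =>
    have : s ⊆ {o} := fun x hx => by
      rw [Finset.mem_singleton]
      exact (hG.isTree.connected.dist_eq_zero_iff.1 (hs x hx)).symm
    have := Finset.card_le_card this
    rw [Finset.card_singleton] at this
    simp only [pow_zero]
    omega
  | succ n =>
    refine (hG.card_le_of_dist_eq_succ n s hs).trans ?_
    gcongr <;> omega

/-- The factor `q^(-|x|)` offsets the size of the spheres, leaving a multiple of `∑ (1 + n)^(-2)`.
-/
theorem IsHomogeneousTree.summable_pow_dist [G.LocallyFinite] (hG : IsHomogeneousTree G q)
    (o : X) : Summable fun x =>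
      ((q : ℝ) ^ G.dist o x)⁻¹ * ((1 + (G.dist o x : ℝ)) ^ 2)⁻¹ := by
  classical
  have hq : (0 : ℝ) < q := by exact_mod_cast lt_of_lt_of_le (by norm_num) hG.two_le
  have hsum : Summable fun n : ℕ => ((q : ℝ) + 1) * ((1 + (n : ℝ)) ^ 2)⁻¹ := by
    refine Summable.mul_left _ ?_
    have := (summable_nat_add_iff 1).2 (Real.summable_nat_pow_inv.2 (by norm_num : 1 < 2))
    refine this.congr fun n => ?_
    push_cast
    rw [add_comm]
  refine summable_of_sum_le (c := ∑' n : ℕ, ((q : ℝ) + 1) * ((1 + (n : ℝ)) ^ 2)⁻¹)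
    (fun x => by positivity) fun s => ?_
  rw [Finset.sum_comp (fun n : ℕ => ((q : ℝ) ^ n)⁻¹ * ((1 + (n : ℝ)) ^ 2)⁻¹) (G.dist o)]
  refine le_trans (Finset.sum_le_sum fun n _ => ?_)
    (hsum.sum_le_tsum (s.image (G.dist o)) fun n _ => by positivity)
  have hc := hG.card_le_of_dist_eq (o := o) n (s.filter fun x => G.dist o x = n)
    (fun x hx => (Finset.mem_filter.1 hx).2)
  have hc' : ((s.filter fun x => G.dist o x = n).card : ℝ) ≤ ((q : ℝ) + 1) * (q : ℝ) ^ n := by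
    exact_mod_cast hc
  rw [nsmul_eq_mul]
  calc _ ≤ (((q : ℝ) + 1) * (q : ℝ) ^ n) * (((q : ℝ) ^ n)⁻¹ * ((1 + (n : ℝ)) ^ 2)⁻¹) := by gcongr
    _ = _ := by field_simp

/-- Functions bounded by `(1 + |x|) q ^ (-|x| / p')`, where `p'` is the conjugate exponent. -/
def HasDualGrowth (G : SimpleGraph X) (q : ℕ) (o : X) (p : ℝ) (φ : X → ℂ) : Prop :=
  ∃ C : ℝ, 0 ≤ C ∧ ∀ x, ‖φ x‖ ≤
    C * ((1 + (G.dist o x : ℝ)) * ((q * (q : ℝ) ^ (-(1 / p)))⁻¹) ^ G.dist o x)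

/-- The exponentials `(q t)^(-|x|)` and `t^|x|` multiply to `q^(-|x|)`. The seminorm `ν_3` is taken
so that, after the growth `1 + |x|`, a summable inverse square remains. -/
theorem HasDualGrowth.exists_norm_mul_le {o : X} {p : ℝ} {φ : X → ℂ}
    (hφ : HasDualGrowth G q o p φ) (hq : 2 ≤ q) : ∃ C : ℝ, 0 ≤ C ∧ ∀ (f : schwartz G q o p) x,
      ‖φ x * f.1 x‖ ≤ C * nu G q o p 3 f *
        (((q : ℝ) ^ G.dist o x)⁻¹ * ((1 + (G.dist o x : ℝ)) ^ 2)⁻¹) := by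
  obtain ⟨C, hC, h⟩ := hφ
  have hq0 : (0 : ℝ) < q := by exact_mod_cast (by omega : 0 < q)
  refine ⟨C, hC, fun f x => ?_⟩
  rw [norm_mul]
  have ht : 0 < (q : ℝ) ^ (-(1 / p)) := Real.rpow_pos_of_pos hq0 _
  refine (mul_le_mul (h x) (norm_le_nu hq 3 f x) (norm_nonneg _) (by positivity)).trans
    (le_of_eq ?_)
  rw [inv_pow, mul_pow]
  field_simp

theorem HasDualGrowth.summable_norm [G.LocallyFinite] {o : X} {p : ℝ} {φ : X → ℂ}
    (hφ : HasDualGrowth G q o p φ) (hG : IsHomogeneousTree G q) (f : schwartz G q o p) :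
    Summable fun x => ‖φ x * f.1 x‖ := by
  obtain ⟨C, -, h⟩ := hφ.exists_norm_mul_le hG.two_le
  exact .of_nonneg_of_le (fun _ => norm_nonneg _) (h f) ((hG.summable_pow_dist o).mul_left _)

/-- The distribution given by a function of dual growth. -/
noncomputable def HasDualGrowth.toDist [G.LocallyFinite] {o : X} {p : ℝ} {φ : X → ℂ}
    (hφ : HasDualGrowth G q o p φ) (hG : IsHomogeneousTree G q) : schwartz G q o p →ₗ[ℂ] ℂ where
  toFun f := ∑' x, φ x * f.1 x
  map_add' f g := (tsum_congr fun _ => mul_add _ _ _).trans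
    ((hφ.summable_norm hG f).of_norm.tsum_add (hφ.summable_norm hG g).of_norm)
  map_smul' c f := by
    rw [RingHom.id_apply, smul_eq_mul, ← tsum_mul_left]
    exact tsum_congr fun x => mul_left_comm _ _ _

theorem HasDualGrowth.exists_norm_toDist_le [G.LocallyFinite] {o : X} {p : ℝ} {φ : X → ℂ}
    (hφ : HasDualGrowth G q o p φ) (hG : IsHomogeneousTree G q) :
    ∃ C : ℝ, 0 ≤ C ∧ ∀ f, ‖hφ.toDist hG f‖ ≤ C * nu G q o p 3 f := by
  obtain ⟨C, hC, h⟩ := hφ.exists_norm_mul_le hG.two_le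
  refine ⟨C * ∑' x, (((q : ℝ) ^ G.dist o x)⁻¹ * ((1 + (G.dist o x : ℝ)) ^ 2)⁻¹),
    mul_nonneg hC (tsum_nonneg fun x => by positivity), fun f => ?_⟩
  have hs := hG.summable_pow_dist o
  calc ‖∑' x, φ x * f.1 x‖ ≤ ∑' x, ‖φ x * f.1 x‖ := norm_tsum_le_tsum_norm (hφ.summable_norm hG f)
    _ ≤ ∑' x, C * nu G q o p 3 f *
        (((q : ℝ) ^ G.dist o x)⁻¹ * ((1 + (G.dist o x : ℝ)) ^ 2)⁻¹) :=
      (hφ.summable_norm hG f).tsum_le_tsum (h f) (hs.mul_left _)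
    _ = _ := by rw [tsum_mul_left]; ring

/-- The absolute value of a Schwartz function. -/
noncomputable def absSchwartz {o : X} {p : ℝ} (f : schwartz G q o p) : schwartz G q o p :=
  ⟨fun x => (‖f.1 x‖ : ℂ), fun m => by simpa using f.2 m⟩

/-- Summation by parts against the adjacency relation. -/
theorem HasDualGrowth.tsum_mul_sum_neighbor [G.LocallyFinite] {o : X} {p : ℝ} {φ : X → ℂ}
    (hφ : HasDualGrowth G q o p φ) (hG : IsHomogeneousTree G q) (f : schwartz G q o p) :
    ∑' x, φ x * ∑ y ∈ G.neighborFinset x, f.1 y = ∑' x, (∑ y ∈ G.neighborFinset x, φ y) * f.1 x := by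
  classical
  set A : X → X → ℂ := fun x y => if G.Adj x y then φ x * f.1 y else 0 with hA
  have hrow : ∀ x, HasSum (fun y => A x y) (φ x * ∑ y ∈ G.neighborFinset x, f.1 y) := by
    intro x
    have h : HasSum (fun y => A x y) (∑ y ∈ G.neighborFinset x, A x y) := hasSum_sum_of_ne_finset_zero
      (fun y hy => if_neg (by simpa using hy))
    convert h using 1
    rw [Finset.mul_sum]
    exact Finset.sum_congr rfl fun y hy => (if_pos (by simpa using hy)).symm
  have hcol : ∀ y, HasSum (fun x => A x y) ((∑ x ∈ G.neighborFinset y, φ x) * f.1 y) := by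
    intro y
    have h : HasSum (fun x => A x y) (∑ x ∈ G.neighborFinset y, A x y) := hasSum_sum_of_ne_finset_zero
      (fun x hx => if_neg (by simpa [G.adj_comm] using hx))
    convert h using 1
    rw [Finset.sum_mul]
    exact Finset.sum_congr rfl fun x hx => (if_pos (by simpa [G.adj_comm] using hx)).symm
  have hnorm : ∀ x, HasSum (fun y => ‖A x y‖) (‖φ x‖ * ∑ y ∈ G.neighborFinset x, ‖f.1 y‖) := by
    intro x
    have h : HasSum (fun y => ‖A x y‖) (∑ y ∈ G.neighborFinset x, ‖A x y‖) := hasSum_sum_of_ne_finset_zero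
      (fun y hy => by simp only [hA, if_neg (mt (G.mem_neighborFinset x y).2 hy), norm_zero])
    convert h using 1
    rw [Finset.mul_sum]
    refine Finset.sum_congr rfl fun y hy => ?_
    rw [hA]
    simp only [if_pos ((G.mem_neighborFinset x y).1 hy), norm_mul]
  have hsum : Summable (Function.uncurry A) := by
    refine Summable.of_norm ((summable_prod_of_nonneg fun _ => norm_nonneg _).2
      ⟨fun x => (hnorm x).summable, ?_⟩)
    -- Absolute summability of the double sum is that of `φ` paired with the average of `|f|`, which
    -- is again a Schwartz function.
    have h1 := (hφ.summable_norm hG (average hG o p (absSchwartz f))).mul_left ((q : ℝ) + 1)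
    refine h1.congr fun x => ?_
    refine Eq.trans ?_ (hnorm x).tsum_eq.symm
    have hq : (q : ℝ) + 1 ≠ 0 := by positivity
    have e : (average hG o p (absSchwartz f)).1 x =
        ((1 / ((q : ℝ) + 1) * ∑ y ∈ G.neighborFinset x, ‖f.1 y‖ : ℝ) : ℂ) := by
      rw [average_apply]
      simp [absSchwartz]
    rw [e, norm_mul, Complex.norm_real, Real.norm_of_nonneg (by positivity)]
    field_simp
  calc _ = ∑' x, ∑' y, A x y := tsum_congr fun x => (hrow x).tsum_eq.symm
    _ = ∑' y, ∑' x, A x y := (Summable.tsum_comm hsum).symm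
    _ = _ := tsum_congr fun y => (hcol y).tsum_eq

theorem HasDualGrowth.laplacianDist_toDist [G.LocallyFinite] {o : X} {p : ℝ} {φ : X → ℂ}
    (hφ : HasDualGrowth G q o p φ) (hG : IsHomogeneousTree G q) {μ : ℂ}
    (hμ : ∀ x, ∑ y ∈ G.neighborFinset x, φ y = ((q : ℂ) + 1) * μ * φ x) :
    laplacianDist hG (hφ.toDist hG) = (1 - μ) • hφ.toDist hG := by
  ext f
  have hq : (q : ℂ) + 1 ≠ 0 := by exact_mod_cast (by positivity : (q : ℝ) + 1 ≠ 0)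
  have e : laplacianSchwartz hG o p f = f - average hG o p f := by simp [average]
  have h1 : hφ.toDist hG (average hG o p f) = μ * hφ.toDist hG f := by
    calc ∑' x, φ x * (average hG o p f).1 x
        = ∑' x, (1 / ((q : ℂ) + 1)) * (φ x * ∑ y ∈ G.neighborFinset x, f.1 y) :=
          tsum_congr fun x => by rw [average_apply]; ring
      _ = (1 / ((q : ℂ) + 1)) * ∑' x, (((q : ℂ) + 1) * μ) * (φ x * f.1 x) := by
          rw [tsum_mul_left, hφ.tsum_mul_sum_neighbor hG f]
          simp only [hμ, mul_assoc]
      _ = μ * ∑' x, φ x * f.1 x := by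
          rw [tsum_mul_left]; field_simp
  rw [laplacianDist, LinearMap.comp_apply, e, map_sub, h1, LinearMap.smul_apply, smul_eq_mul]
  ring

/-- The point mass at a vertex. -/
noncomputable def pointMass (G : SimpleGraph X) (q : ℕ) (o : X) (p : ℝ) (z : X) :
    schwartz G q o p := by
  classical
  refine ⟨Pi.single z 1, fun m => ⟨weight G q o p m z, ?_⟩⟩
  rintro _ ⟨x, rfl⟩
  rcases eq_or_ne x z with rfl | h
  · simp
  · simpa [h] using weight_nonneg G q o p m z

theorem HasDualGrowth.toDist_pointMass [G.LocallyFinite] {o : X} {p : ℝ} {φ : X → ℂ}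
    (hφ : HasDualGrowth G q o p φ) (hG : IsHomogeneousTree G q) (z : X) :
    hφ.toDist hG (pointMass G q o p z) = φ z := by
  classical
  refine (tsum_eq_single z fun x hx => ?_).trans ?_
  · simp [pointMass, hx]
  · simp [pointMass]

/-! ### Spherical functions and part (c). -/

/-- The values of the spherical function with average `μ`. -/
noncomputable def sphericalSeq (q : ℕ) (μ : ℂ) : ℕ → ℂ
  | 0 => 1
  | 1 => μ
  | n + 2 => (((q : ℂ) + 1) * μ * sphericalSeq q μ (n + 1) - sphericalSeq q μ n) / q

theorem IsHomogeneousTree.sum_sphericalSeq [G.LocallyFinite] (hG : IsHomogeneousTree G q)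
    (o : X) (μ : ℂ) (x : X) : ∑ y ∈ G.neighborFinset x, sphericalSeq q μ (G.dist o y) =
      ((q : ℂ) + 1) * μ * sphericalSeq q μ (G.dist o x) := by
  have hq : (q : ℂ) ≠ 0 := by
    have := hG.two_le
    exact_mod_cast (by omega : q ≠ 0)
  rcases eq_or_ne x o with rfl | hne
  · rw [hG.sum_radial_root, SimpleGraph.dist_self]
    simp [sphericalSeq]
  · obtain ⟨z, -, hd, -⟩ := hG.isTree.exists_parent hne
    rw [hG.sum_radial hd, hd, nsmul_eq_mul, sphericalSeq]
    field_simp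
    ring

/-- The recursion has characteristic roots `α` and `(q α)⁻¹`, so `a (n + 1) - α a n` is geometric
with ratio `(q α)⁻¹`. Summing back costs the factor `1 + n`, and no distinctness of the roots is
needed. -/
theorem exists_norm_sphericalSeq_le {q : ℕ} (hq : q ≠ 0) {α : ℂ} (hα0 : α ≠ 0) {r : ℝ}
    (hα : ‖α‖ ≤ r) (hβ : ‖((q : ℂ) * α)⁻¹‖ ≤ r) : ∃ C : ℝ, 0 ≤ C ∧ ∀ n,
      ‖sphericalSeq q ((q * α + α⁻¹) / (q + 1)) n‖ ≤ C * ((1 + n) * r ^ n) := by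
  have hqc : (q : ℂ) ≠ 0 := by exact_mod_cast hq
  have hq1 : (q : ℂ) + 1 ≠ 0 := by exact_mod_cast Nat.succ_ne_zero q
  have hr : 0 < r := lt_of_lt_of_le (by positivity) hα
  set a := sphericalSeq q ((q * α + α⁻¹) / (q + 1)) with ha
  have hrec : ∀ n, a (n + 2) - α * a (n + 1) = ((q : ℂ) * α)⁻¹ * (a (n + 1) - α * a n) := by
    intro n
    rw [ha, sphericalSeq]
    field_simp
    ring
  set D : ℝ := ‖a 1 - α * a 0‖
  have hd : ∀ n, ‖a (n + 1) - α * a n‖ ≤ r ^ n * D := by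
    intro n
    induction n with
    | zero => simp [D]
    | succ n ih =>
      rw [hrec, norm_mul, pow_succ', mul_assoc]
      gcongr
  refine ⟨1 + D / r, by positivity, fun n => ?_⟩
  induction n with
  | zero =>
    have : 0 ≤ D / r := by positivity
    simp [ha, sphericalSeq, this]
  | succ n ih =>
    have e : a (n + 1) = α * a n + (a (n + 1) - α * a n) := by ring
    rw [e]
    refine (norm_add_le _ _).trans ?_
    rw [norm_mul]
    calc ‖α‖ * ‖a n‖ + ‖a (n + 1) - α * a n‖
        ≤ r * ((1 + D / r) * ((1 + n) * r ^ n)) + r ^ n * D := by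
          gcongr
          exact hd n
      _ ≤ r * ((1 + D / r) * ((1 + n) * r ^ n)) + (r ^ n * D + r ^ (n + 1)) := by
          gcongr
          exact le_add_of_nonneg_right (by positivity)
      _ = _ := by
          push_cast
          field_simp
          ring

/-- Two spherical functions of dual growth with distinct eigenvalues of the same modulus give
a bounded sequence of distributions without eigendistributions. -/
theorem exists_isRoeSequence_of_two_eigenvalues [G.LocallyFinite] (hG : IsHomogeneousTree G q)
    {o : X} {p : ℝ} {lam μ₁ μ₂ : ℂ} (hlam : lam ≠ 0) (hne : μ₁ ≠ μ₂) (h₁ : ‖1 - μ₁‖ = ‖lam‖)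
    (h₂ : ‖1 - μ₂‖ = ‖lam‖)
    (hg₁ : HasDualGrowth G q o p fun x => sphericalSeq q μ₁ (G.dist o x))
    (hg₂ : HasDualGrowth G q o p fun x => sphericalSeq q μ₂ (G.dist o x)) :
    ∃ T : ℕ → (schwartz G q o p →ₗ[ℂ] ℂ), IsRoeSequence hG lam T ∧
      ∀ k, ¬ ∃ c : ℂ, laplacianDist hG (T k) = c • T k := by
  have hlam' : ‖lam‖ ≠ 0 := norm_ne_zero_iff.2 hlam
  have hn₁ : ‖(1 - μ₁) / lam‖ = 1 := by rw [norm_div, h₁, div_self hlam']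
  have hn₂ : ‖(1 - μ₂) / lam‖ = 1 := by rw [norm_div, h₂, div_self hlam']
  set S₁ := hg₁.toDist hG
  set S₂ := hg₂.toDist hG
  have hL₁ : laplacianDist hG S₁ = (1 - μ₁) • S₁ :=
    hg₁.laplacianDist_toDist hG (hG.sum_sphericalSeq o μ₁)
  have hL₂ : laplacianDist hG S₂ = (1 - μ₂) • S₂ :=
    hg₂.laplacianDist_toDist hG (hG.sum_sphericalSeq o μ₂)
  have hL : ∀ a b : ℂ, laplacianDist hG (a • S₁ + b • S₂) =
      (a * (1 - μ₁)) • S₁ + (b * (1 - μ₂)) • S₂ := by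
    intro a b
    have : laplacianDist hG (a • S₁ + b • S₂) =
      a • laplacianDist hG S₁ + b • laplacianDist hG S₂ := rfl
    rw [this, hL₁, hL₂, smul_smul, smul_smul]
  obtain ⟨C₁, hC₁, hb₁⟩ := hg₁.exists_norm_toDist_le hG
  obtain ⟨C₂, hC₂, hb₂⟩ := hg₂.exists_norm_toDist_le hG
  have hb : ∀ (k : ℕ) φ, ‖(((1 - μ₁) / lam) ^ k • S₁ + ((1 - μ₂) / lam) ^ k • S₂) φ‖ ≤
      (C₁ + C₂ + 1) * nu G q o p 3 φ := by
    intro k φ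
    have hnu := apply_nonneg (nu G q o p 3) φ
    rw [LinearMap.add_apply, LinearMap.smul_apply, LinearMap.smul_apply]
    refine (norm_add_le _ _).trans ?_
    rw [norm_smul, norm_smul, norm_pow, norm_pow, hn₁, hn₂, one_pow, one_mul, one_mul]
    linarith [hb₁ φ, hb₂ φ]
  -- Each application of `𝓛 / λ` multiplies the two components by numbers of modulus one, so the
  -- sequence stays bounded.
  refine ⟨fun k => ((1 - μ₁) / lam) ^ k • S₁ + ((1 - μ₂) / lam) ^ k • S₂, ⟨?_, ?_, ?_⟩, ?_⟩
  · intro k f hf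
    refine squeeze_zero_norm (fun n => hb k (f n)) ?_
    simpa using (hf 3).const_mul (C₁ + C₂ + 1)
  · intro k
    rw [hL, smul_add, smul_smul, smul_smul, pow_succ, pow_succ]
    congr 2 <;> field_simp
  · exact ⟨nu G q o p 3, fun f hf => hf 3, C₁ + C₂ + 1, by positivity, hb⟩
  · rintro k ⟨c, hc⟩
    dsimp only at hc
    obtain ⟨z, hz⟩ : (G.neighborFinset o).Nonempty := by
      rw [← Finset.card_pos, SimpleGraph.card_neighborFinset_eq_degree, hG.degree_eq]
      omega
    have hz1 : G.dist o z = 1 := SimpleGraph.dist_eq_one_iff_adj.2 (by simpa using hz)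
    have ha : ((1 - μ₁) / lam) ^ k ≠ 0 := pow_ne_zero _ (norm_ne_zero_iff.1 (hn₁.trans_ne one_ne_zero))
    have hb : ((1 - μ₂) / lam) ^ k ≠ 0 := pow_ne_zero _ (norm_ne_zero_iff.1 (hn₂.trans_ne one_ne_zero))
    generalize ((1 - μ₁) / lam) ^ k = a at ha hc
    generalize ((1 - μ₂) / lam) ^ k = b at hb hc
    rw [hL] at hc
    -- At `o` and at a neighbour the spherical functions take the values `1` and `μ`; the
    -- determinant `μ₂ - μ₁ ≠ 0` separates the components, so `c` would equal both eigenvalues.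
    have ho := congrArg (fun S => S (pointMass G q o p o)) hc
    have hz := congrArg (fun S => S (pointMass G q o p z)) hc
    simp only [LinearMap.add_apply, LinearMap.smul_apply, smul_eq_mul, S₁, S₂,
      HasDualGrowth.toDist_pointMass, SimpleGraph.dist_self, hz1, sphericalSeq] at ho hz
    have hμ : μ₁ - μ₂ ≠ 0 := sub_ne_zero.2 hne
    have e₁ : 1 - μ₁ - c = 0 := by
      have : a * (μ₁ - μ₂) * (1 - μ₁ - c) = 0 := by linear_combination hz - μ₂ * ho
      exact (mul_eq_zero.1 this).resolve_left (mul_ne_zero ha hμ)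
    have e₂ : 1 - μ₂ - c = 0 := by
      have : b * (μ₁ - μ₂) * (1 - μ₂ - c) = 0 := by linear_combination μ₁ * ho - hz
      exact (mul_eq_zero.1 this).resolve_left (mul_ne_zero hb hμ)
    exact hne (by linear_combination e₂ - e₁)

/-- The other root has modulus `(q t)⁻¹`, which dominates `|α| = t` exactly when `q t² ≤ 1`. -/
theorem hasDualGrowth_sphericalSeq (hq : 2 ≤ q) (o : X) {p : ℝ} {α : ℂ}
    (hα : ‖α‖ = (q : ℝ) ^ (-(1 / p))) (hqt : (q : ℝ) * ((q : ℝ) ^ (-(1 / p))) ^ 2 ≤ 1) :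
    HasDualGrowth G q o p fun x => sphericalSeq q ((q * α + α⁻¹) / (q + 1)) (G.dist o x) := by
  have hq0 : (0 : ℝ) < q := by exact_mod_cast (by omega : 0 < q)
  have ht : 0 < (q : ℝ) ^ (-(1 / p)) := Real.rpow_pos_of_pos hq0 _
  obtain ⟨C, hC, h⟩ := exists_norm_sphericalSeq_le (q := q) (by omega) (α := α)
    (norm_ne_zero_iff.1 (by rw [hα]; exact ht.ne')) (r := (q * (q : ℝ) ^ (-(1 / p)))⁻¹)
    (by rw [hα, ← one_div, le_div_iff₀ (by positivity)]; linarith)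
    (by rw [norm_inv, norm_mul, hα, Complex.norm_natCast])
  exact ⟨C, hC, fun x => h _⟩

/-- As `1/p' = 1 - 1/p`, the exponents `1/2 ∓ δ_{p'}` are `1/p` and `1 - 1/p`, those of `t⁻¹` and `q
t`. -/
theorem gamma_conjExponent_re (hq : 2 ≤ q) {p : ℝ} (hp1 : 1 < p) :
    (gamma q (Complex.I * delta (Real.conjExponent p))).re = 1 - rate q p ∧
    (gamma q ((tau q : ℂ) / 2 + Complex.I * delta (Real.conjExponent p))).re = 1 + rate q p := by
  have hq0 : (0 : ℝ) < q := by exact_mod_cast (by omega : 0 < q)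
  have hp0 : p ≠ 0 := by linarith
  have hp1' : p - 1 ≠ 0 := by linarith
  have e1 : 1 / 2 - delta (Real.conjExponent p) = 1 / p := by
    unfold delta Real.conjExponent; field_simp; ring
  have e2 : 1 / 2 + delta (Real.conjExponent p) = 1 + -(1 / p) := by
    unfold delta Real.conjExponent; field_simp; ring
  rw [gamma_I_mul, gamma_tau_add_I_mul hq, Complex.ofReal_re, Complex.ofReal_re, e1, e2,
    Real.rpow_add hq0, Real.rpow_one, rate, Real.rpow_neg hq0.le, inv_inv,
    add_comm (q * ((q : ℝ) ^ (1 / p))⁻¹)]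
  exact ⟨rfl, rfl⟩

theorem exists_isRoeSequence_no_eigendistribution [G.LocallyFinite] (hG : IsHomogeneousTree G q)
    (o : X) {p : ℝ} (hp1 : 1 < p) (hp2 : p < 2) {lam : ℂ} (hlam : lam ≠ 0)
    (h1 : 1 - rate q p < ‖lam‖) (h2 : ‖lam‖ < 1 + rate q p) :
    ∃ T : ℕ → (schwartz G q o p →ₗ[ℂ] ℂ), IsRoeSequence hG lam T ∧
      ∀ k, ¬ ∃ c : ℂ, laplacianDist hG (T k) = c • T k := by
  have hq1 : (1 : ℝ) < q := by exact_mod_cast lt_of_lt_of_le (by norm_num) hG.two_le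
  have hq0 : (0 : ℝ) < q := by linarith
  have hpos := rate_pos hG.two_le p
  have hrate : rate q p = (q * (q : ℝ) ^ (-(1 / p)) + ((q : ℝ) ^ (-(1 / p)))⁻¹) / (q + 1) := rfl
  set t : ℝ := (q : ℝ) ^ (-(1 / p)) with ht
  have hpi : 1 / p < 1 := by rw [div_lt_one (by linarith)]; exact hp1
  have hpi2 : 1 / 2 < 1 / p := one_div_lt_one_div_of_lt (by linarith) hp2
  have ht0 : 0 < t := Real.rpow_pos_of_pos hq0 _
  have ht1 : t < 1 := Real.rpow_lt_one_of_one_lt_of_neg hq1 (by linarith)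
  have hqt : 1 < q * t := by
    have : (q : ℝ) * t = (q : ℝ) ^ (1 + -(1 / p)) := by rw [Real.rpow_add hq0, Real.rpow_one]
    rw [this]
    exact Real.one_lt_rpow hq1 (by linarith)
  have hqt2 : q * t ^ 2 < 1 := by
    have : (q : ℝ) * t ^ 2 = (q : ℝ) ^ (1 + -(1 / p) + -(1 / p)) := by
      rw [Real.rpow_add hq0, Real.rpow_add hq0, Real.rpow_one]; ring
    rw [this]
    exact Real.rpow_lt_one_of_one_lt_of_neg hq1 (by linarith)
  -- Needed for `|1 - m 0|` to equal `1 - ρ`; it follows from `q⁻¹ < t < 1`.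
  have hr1 : rate q p < 1 := by
    rw [hrate, div_lt_one (by linarith)]
    have : (q : ℝ) + 1 - (q * t + t⁻¹) = (1 - t) * (q * t - 1) / t := by field_simp; ring
    have h3 : 0 < (1 - t) * (q * t - 1) / t := by
      have : 0 < 1 - t := by linarith
      have : 0 < q * t - 1 := by linarith
      positivity
    linarith
  set m : ℝ → ℂ := fun θ => (q * (t * Complex.exp (θ * Complex.I)) +
    (t * Complex.exp (θ * Complex.I))⁻¹) / (q + 1) with hm
  have htc : (t : ℂ) ≠ 0 := by exact_mod_cast ht0.ne'
  have hqc : (q : ℂ) + 1 ≠ 0 := by exact_mod_cast (by positivity : (q : ℝ) + 1 ≠ 0)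
  have hcont : Continuous fun θ => ‖1 - m θ‖ := by
    have : ∀ θ : ℝ, (t : ℂ) * Complex.exp (θ * Complex.I) ≠ 0 := fun θ =>
      mul_ne_zero htc (Complex.exp_ne_zero _)
    fun_prop (disch := assumption)
  have hm0 : m 0 = (rate q p : ℝ) := by
    rw [hrate]; simp [hm]
  have hmpi : m Real.pi = (-rate q p : ℝ) := by
    rw [hrate]; simp [hm, Complex.exp_pi_mul_I]; ring
  have hn0 : ‖1 - m 0‖ = 1 - rate q p := by
    rw [hm0, ← Complex.ofReal_one, ← Complex.ofReal_sub, Complex.norm_real,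
      Real.norm_of_nonneg (by linarith)]
  have hnpi : ‖1 - m Real.pi‖ = 1 + rate q p := by
    rw [hmpi, ← Complex.ofReal_one, ← Complex.ofReal_sub, sub_neg_eq_add, Complex.norm_real,
      Real.norm_of_nonneg (by linarith)]
  -- Along the upper or lower half of the ellipse, `|1 - m θ|` runs from `1 - ρ` to `1 + ρ`. The
  -- strict bounds on `|λ|` keep `θ` off the endpoints, the only places in `[0, π]` where `m θ` is
  -- real.
  obtain ⟨θ, hθ, hθlam⟩ := intermediate_value_Icc Real.pi_pos.le hcont.continuousOn
    (show ‖lam‖ ∈ Set.Icc ‖1 - m 0‖ ‖1 - m Real.pi‖ from by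
      rw [hn0, hnpi]; exact ⟨h1.le, h2.le⟩)
  dsimp only at hθlam
  have hθ0 : θ ≠ 0 := by rintro rfl; linarith
  have hθpi : θ ≠ Real.pi := by rintro rfl; linarith
  have hsin : 0 < Real.sin θ :=
    Real.sin_pos_of_pos_of_lt_pi (lt_of_le_of_ne hθ.1 hθ0.symm) (lt_of_le_of_ne hθ.2 hθpi)
  have hconj : m (-θ) = (starRingEnd ℂ) (m θ) := by
    simp [hm, ← Complex.exp_conj]
  have him : (m θ).im = (q * t - t⁻¹) * Real.sin θ / (q + 1) := by
    have e : m θ = ((q * t : ℝ) * Complex.exp (θ * Complex.I) +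
        (t⁻¹ : ℝ) * Complex.exp ((-θ : ℝ) * Complex.I)) / ((q + 1 : ℝ) : ℂ) := by
      rw [hm]
      push_cast
      rw [mul_inv, ← Complex.exp_neg, neg_mul, mul_assoc]
    rw [e, Complex.div_ofReal_im, Complex.add_im, Complex.im_ofReal_mul, Complex.im_ofReal_mul,
      Complex.exp_ofReal_mul_I_im, Complex.exp_ofReal_mul_I_im, Real.sin_neg]
    ring
  have him0 : (m θ).im ≠ 0 := by
    rw [him]
    have : q * t - t⁻¹ ≠ 0 := by
      have : t * (q * t - t⁻¹) = q * t ^ 2 - 1 := by field_simp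
      intro h0
      rw [h0] at this
      linarith
    positivity
  have hnorm : ∀ θ : ℝ, ‖(t : ℂ) * Complex.exp (θ * Complex.I)‖ = (q : ℝ) ^ (-(1 / p)) := by
    intro θ
    rw [norm_mul, Complex.norm_exp_ofReal_mul_I, Complex.norm_real, Real.norm_of_nonneg ht0.le,
      mul_one]
  refine exists_isRoeSequence_of_two_eigenvalues hG hlam (μ₁ := m θ) (μ₂ := m (-θ)) ?_ hθlam ?_
    (hasDualGrowth_sphericalSeq hG.two_le o (hnorm _) hqt2.le)
    (hasDualGrowth_sphericalSeq hG.two_le o (hnorm _) hqt2.le)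
  · intro h
    rw [hconj] at h
    exact him0 (Complex.conj_eq_iff_im.1 h.symm)
  · rw [hconj, ← hθlam, ← Complex.norm_conj (1 - m θ), map_sub, map_one]

end HomTree

theorem lemmaB1 {X : Type*} (G : SimpleGraph X) [G.LocallyFinite] (q : ℕ)
    (hG : IsHomogeneousTree G q) (o : X) (p : ℝ) (hp1 : 1 < p) (hp2 : p < 2)
    (lam : ℂ) (hlam : lam ≠ 0) :
    -- (a)
    (‖lam‖ = (gamma q (Complex.I * delta (Real.conjExponent p))).re →
      ∀ T : ℕ → (schwartz G q o p →ₗ[ℂ] ℂ), IsRoeSequence hG lam T →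
        laplacianDist hG (T 0) = (‖lam‖ : ℂ) • T 0) ∧
    -- (b)
    (‖lam‖ < (gamma q (Complex.I * delta (Real.conjExponent p))).re →
      ∀ T : ℕ → (schwartz G q o p →ₗ[ℂ] ℂ), IsRoeSequence hG lam T → ∀ k, T k = 0) ∧
    -- (c)
    ((gamma q (Complex.I * delta (Real.conjExponent p))).re < ‖lam‖ →
      ‖lam‖ < (gamma q ((tau q : ℂ) / 2 + Complex.I * delta (Real.conjExponent p))).re →
      ∃ T : ℕ → (schwartz G q o p →ₗ[ℂ] ℂ), IsRoeSequence hG lam T ∧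
        ∀ k, ¬ ∃ c : ℂ, laplacianDist hG (T k) = c • T k) := by
  obtain ⟨e1, e2⟩ := gamma_conjExponent_re hG.two_le hp1
  rw [e1, e2]
  have hp0 : 0 < p := by linarith
  exact ⟨fun h _ hT => hT.laplacianDist_eq hp0 hlam h,
    fun h _ hT k => hT.eq_zero hp0 (by linarith) k,
    fun h1 h2 => exists_isRoeSequence_no_eigendistribution hG o hp1 hp2 hlam h1 h2⟩
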